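/- **Notation.** A Boolean function is a function $\{-1,1\}^r\to\{-1,1\}$; $\mathrm{dep}(f)$ is the set of coordinates on which $f$ depends, and $\deg f$ is the degree of its Fourier expansion. Let $n,m\ge 0$. Boolean functions $f_0,f_1,\dots,f_m$ on $\{-1,1\}^n$ and $g_0,g_1,\dots,g_n$ on $\{-1,1\}^m$ form a *Boolean generalized polymorphism* if for every $z\in\{-1,1\}^{n\times m}$ $$f_0\bigl(g_1(z_{1\cdot}),\dots,g_n(z_{n\cdot})\bigr)=g_0\bigl(f_1(z_{\cdot 1}),\dots,f_m(z_{\cdot m})\bigr).$$ **Data.** For $W\subseteq[n]\times[m]$ let $\mathrm{rows}(W),\mathrm{cols}(W)$ be its projections, and let $\mathrm{rows}_{=1}(W)$, $\mathrm{rows}_{\ge2}(W)$ be the sets of rows containing exactly one, respectively at least two, elements of $W$; similarly for columns. *Solution data* consist of the following. * Non-empty blocks $Z_1,\dots,Z_k\subseteq[n]\times[m]$, pairwise disjoint in rows and in columns, with union $Z_0$, such that in a block with more than one element no element is alone both in its row and in its column. Put $\mathrm{dep}_1(f_j)=\{i:(i,j)\in Z_0,\ i\in\mathrm{rows}_{=1}(Z_0)\}$,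 $\mathrm{dep}_2(f_j)=\{i:(i,j)\in Z_0,\ i\in\mathrm{rows}_{\ge2}(Z_0)\}$, $\mathrm{dep}_1(g_i)=\{j:(i,j)\in Z_0,\ j\in\mathrm{cols}_{=1}(Z_0)\}$, $\mathrm{dep}_2(g_i)=\{j:(i,j)\in Z_0,\ j\in\mathrm{cols}_{\ge2}(Z_0)\}$. * A function $h:\{-1,1\}^k\to\{-1,1\}$. * Signs $\mathrm{sgn}(f_j),\mathrm{sgn}(g_i)\in\{-1,1\}$, functions $\varphi_j:\{-1,1\}^{\mathrm{dep}_1(f_j)}\to\mathbb R$, $\gamma_i:\{-1,1\}^{\mathrm{dep}_1(g_i)}\to\mathbb R$, and reals $B_j,D_i,\kappa_{ij}$ with $B_j=0$ if $j\notin\mathrm{cols}_{\ge2}(Z_0)$, $D_i=0$ if $i\notin\mathrm{rows}_{\ge2}(Z_0)$, and $\kappa_{ij}=0$ unless $(i,j)\in Z_0$, $i\in\mathrm{rows}_{\ge2}(Z_0)$ and $j\in\mathrm{cols}_{\ge2}(Z_0)$. * A kind for every block: *singleton* if $|Z_\ell|=1$; otherwise *XOR-like* or *AND/OR-like*. In an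 XOR-like block, for all $i\in\mathrm{rows}(Z_\ell)$, $j\in\mathrm{cols}(Z_\ell)$: $B_j=D_i=0$, $\kappa_{ij}=0$ whenever $(i,j)\in Z_\ell$, $\varphi_j$ and $\gamma_i$ are $\{-1,1\}$-valued, $\varphi_j\equiv\mathrm{sgn}(f_j)$ if $j\in\mathrm{cols}_{=1}(Z_\ell)$, and $\gamma_i\equiv\mathrm{sgn}(g_i)$ if $i\in\mathrm{rows}_{=1}(Z_\ell)$. In an AND/OR-like block, for all $i\in\mathrm{rows}_{\ge2}(Z_\ell)$, $j\in\mathrm{cols}_{\ge2}(Z_\ell)$: $B_j,D_i\in\{-1,1\}$, $\varphi_j$ and $\gamma_i$ (written $\tilde\varphi_j,\tilde\gamma_i$ below) are $\{0,1\}$-valued, and $\kappa_{ij}\in\{-1,1\}$ whenever $(i,j)\in Z_\ell$. Let $x^{\mathrm{sgn}}$ be $x$ with $x_i$ replaced by $\mathrm{sgn}(g_i)x_i$ for $i\in\mathrm{rows}_{=1}(Z_0)$, and $y^{\mathrm{sgn}}$ be $y$ with $y_j$ replaced by $\mathrm{sgn}(f_j)y_j$ for $j\in\mathrm{cols}_{=1}(Z_0)$.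 The functions $\varphi_j,\gamma_i$ are applied to the restriction of their argument to their domain. The functions $f_0,\dots,f_m,g_0,\dots,g_n$ *have the form given by the data* if there are Boolean functions $f_0^{(\ell)},g_0^{(\ell)}$, $\ell\in[k]$, with $f_0=h(f_0^{(1)},\dots,f_0^{(k)})$ and $g_0=h(g_0^{(1)},\dots,g_0^{(k)})$, such that for every $\ell$: 1. If $Z_\ell=\{(i,j)\}$ is a singleton, then $f_j(x)=\mathrm{sgn}(f_j)x_i$, $g_i(y)=\mathrm{sgn}(g_i)y_j$, $f_0^{(\ell)}(x)=\mathrm{sgn}(f_j)x_i$ and $g_0^{(\ell)}(y)=\mathrm{sgn}(g_i)y_j$. 2. If $Z_\ell$ is XOR-like, then for all $j\in\mathrm{cols}(Z_\ell)$, $i\in\mathrm{rows}(Z_\ell)$ $$f_j(x)=\varphi_j(x)\prod_{i'\in\mathrm{dep}_2(f_j)}x_{i'},\qquad g_i(y)=\gamma_i(y)\prod_{j'\in\mathrm{dep}_2(g_i)}y_{j'},$$ $$f_0^{(\ell)}(x)=\prod_{i\in\mathrm{rows}_{\ge2}(Z_\ell)}x_i\prod_{j\in\mathrm{cols}_{\ge2}(Z_\ell)}\varphi_j(x^{\mathrm{sgn}}),\qquad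 g_0^{(\ell)}(y)=\prod_{j\in\mathrm{cols}_{\ge2}(Z_\ell)}y_j\prod_{i\in\mathrm{rows}_{\ge2}(Z_\ell)}\gamma_i(y^{\mathrm{sgn}}).$$ 3. If $Z_\ell$ is AND/OR-like, then for $(i,j)\in Z_\ell$ we have $f_j(x)=\mathrm{sgn}(f_j)x_i$ if $j\in\mathrm{cols}_{=1}(Z_\ell)$ and $g_i(y)=\mathrm{sgn}(g_i)y_j$ if $i\in\mathrm{rows}_{=1}(Z_\ell)$; and for $j\in\mathrm{cols}_{\ge2}(Z_\ell)$, $i\in\mathrm{rows}_{\ge2}(Z_\ell)$ $$f_j(x)=\tilde\varphi_j(x)\cdot 2B_j\prod_{i'\in\mathrm{dep}_2(f_j)}\frac{\kappa_{i'j}x_{i'}+1}{2}-B_j,\qquad g_i(y)=\tilde\gamma_i(y)\cdot 2D_i\prod_{j'\in\mathrm{dep}_2(g_i)}\frac{\kappa_{ij'}y_{j'}+1}{2}-D_i,$$ $$f_0^{(\ell)}(x)=2\prod_{i\in\mathrm{rows}_{\ge2}(Z_\ell)}\frac{D_ix_i+1}{2}\prod_{j\in\mathrm{cols}_{\ge2}(Z_\ell)}\tilde\varphi_j(x^{\mathrm{sgn}})-1,\qquad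 g_0^{(\ell)}(y)=2\prod_{j\in\mathrm{cols}_{\ge2}(Z_\ell)}\frac{B_jy_j+1}{2}\prod_{i\in\mathrm{rows}_{\ge2}(Z_\ell)}\tilde\gamma_i(y^{\mathrm{sgn}})-1.$$ **Theorem.** (a) Let $f_0,\dots,f_m,g_0,\dots,g_n$ be a Boolean generalized polymorphism in which $f_0$ and $g_0$ depend on all their inputs and $f_1,\dots,f_m,g_1,\dots,g_n$ are non-constant. Then these functions have the form given by some solution data. The data can be chosen such that $Z_0$ is the set of variables on which $f_0\circ(g_1,\dots,g_n)$ depends; $(i,j)\in Z_0\iff j\in\mathrm{dep}(g_i)\iff i\in\mathrm{dep}(f_j)$; the blocks are the connected components of the graph on $Z_0$ that joins two positions sharing a row or a column; $i\in\mathrm{rows}_{=1}(Z_0)\iff\deg g_i=1$ and $i\in\mathrm{rows}_{\ge2}(Z_0)\iff\deg g_i\ge2$, and likewise for columns and the $f_j$; and $h$ depends on all its inputs. (b) Conversely, for all solution data, with any integers $n,m,k\ge 0$, there are Boolean functions that have the form given by the data, and all Boolean functions that have this form are a Boolean generalized polymorphism. -/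

import Mathlib

namespace GenPoly

/-! Boolean functions on the cube with values `1` and `-1`. The two-element set is `ℤˣ`. -/

/-- The Boolean cube of all sign vectors indexed by `ι`. -/
abbrev Cube (ι : Type) : Type := ι → ℤˣ

/-- A Boolean function, that is, a sign-valued function on the cube. -/
abbrev BoolFn (ι : Type) : Type := Cube ι → ℤˣ

/-- The real number `1` or `-1` given by a sign. -/
def val (s : ℤˣ) : ℝ := ((s : ℤ) : ℝ)

section Analysis

variable {ι : Type} [Fintype ι] [DecidableEq ι]

/-- The set of coordinates on which `f` depends. -/
def dep (f : BoolFn ι) : Finset ι :=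
  Finset.univ.filter fun i => ∃ x : Cube ι, f (Function.update x i 1) ≠ f (Function.update x i (-1))

/-- The Fourier coefficient of `f` at `s`: the mean of `f` times the character of `s`. -/
noncomputable def fourierCoeff (f : BoolFn ι) (s : Finset ι) : ℝ :=
  (∑ x : Cube ι, val (f x) * ∏ i ∈ s, val (x i)) / 2 ^ Fintype.card ι

open Classical in
/-- The degree of the Fourier expansion of `f`. -/
noncomputable def degree (f : BoolFn ι) : ℕ :=
  (Finset.univ.filter fun s : Finset ι => fourierCoeff f s ≠ 0).sup Finset.card

end Analysis

/-- `f` is not a constant function. -/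
def NonConstant {ι : Type} (f : BoolFn ι) : Prop := ¬ ∃ c : ℤˣ, ∀ x, f x = c

section Composition

variable {n m : ℕ}

/-- The composition of `f₀` with the row functions `g i`, as a function of the `n × m` matrix. -/
def rowComp (f₀ : BoolFn (Fin n)) (g : Fin n → BoolFn (Fin m)) : BoolFn (Fin n × Fin m) :=
  fun z => f₀ fun i => g i fun j => z (i, j)

/-- The composition of `g₀` with the column functions `f j`, as a function of the matrix. -/
def colComp (g₀ : BoolFn (Fin m)) (f : Fin m → BoolFn (Fin n)) : BoolFn (Fin n × Fin m) :=
  fun z => g₀ fun j => f j fun i => z (i, j)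

/-- The functions form a Boolean generalized polymorphism. -/
def IsGeneralizedPolymorphism (f₀ : BoolFn (Fin n)) (f : Fin m → BoolFn (Fin n))
    (g₀ : BoolFn (Fin m)) (g : Fin n → BoolFn (Fin m)) : Prop :=
  ∀ z : Cube (Fin n × Fin m), rowComp f₀ g z = colComp g₀ f z

/-! Combinatorics of a set `W` of matrix positions. -/

/-- The rows that meet `W`. -/
def rows (W : Finset (Fin n × Fin m)) : Finset (Fin n) := W.image Prod.fst

/-- The columns that meet `W`. -/
def cols (W : Finset (Fin n × Fin m)) : Finset (Fin m) := W.image Prod.snd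

/-- The columns of the elements of `W` in row `i`. -/
def rowEntries (W : Finset (Fin n × Fin m)) (i : Fin n) : Finset (Fin m) :=
  Finset.univ.filter fun j => (i, j) ∈ W

/-- The rows of the elements of `W` in column `j`. -/
def colEntries (W : Finset (Fin n × Fin m)) (j : Fin m) : Finset (Fin n) :=
  Finset.univ.filter fun i => (i, j) ∈ W

/-- The rows with exactly one element of `W`. -/
def rowsOne (W : Finset (Fin n × Fin m)) : Finset (Fin n) :=
  Finset.univ.filter fun i => (rowEntries W i).card = 1

/-- The rows with at least two elements of `W`. -/
def rowsTwo (W : Finset (Fin n × Fin m)) : Finset (Fin n) :=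
  Finset.univ.filter fun i => 2 ≤ (rowEntries W i).card

/-- The columns with exactly one element of `W`. -/
def colsOne (W : Finset (Fin n × Fin m)) : Finset (Fin m) :=
  Finset.univ.filter fun j => (colEntries W j).card = 1

/-- The columns with at least two elements of `W`. -/
def colsTwo (W : Finset (Fin n × Fin m)) : Finset (Fin m) :=
  Finset.univ.filter fun j => 2 ≤ (colEntries W j).card

/-- The inputs of the `i`-th row function that lie in a one-element column. -/
def rowDepOne (W : Finset (Fin n × Fin m)) (i : Fin n) : Finset (Fin m) :=
  rowEntries W i ∩ colsOne W

/-- The inputs of the `i`-th row function that lie in a column with at least two elements. -/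
def rowDepTwo (W : Finset (Fin n × Fin m)) (i : Fin n) : Finset (Fin m) :=
  rowEntries W i ∩ colsTwo W

/-- The inputs of the `j`-th column function that lie in a one-element row. -/
def colDepOne (W : Finset (Fin n × Fin m)) (j : Fin m) : Finset (Fin n) :=
  colEntries W j ∩ rowsOne W

/-- The inputs of the `j`-th column function that lie in a row with at least two elements. -/
def colDepTwo (W : Finset (Fin n × Fin m)) (j : Fin m) : Finset (Fin n) :=
  colEntries W j ∩ rowsTwo W

/-- The graph on `W` in which two distinct positions are adjacent if they share a row or a
column. -/
def entryGraph (W : Finset (Fin n × Fin m)) : SimpleGraph {p : Fin n × Fin m // p ∈ W} where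
  Adj p q := p ≠ q ∧ (p.1.1 = q.1.1 ∨ p.1.2 = q.1.2)
  symm := ⟨fun _ _ hpq => ⟨hpq.1.symm, hpq.2.imp Eq.symm Eq.symm⟩⟩
  loopless := ⟨fun _ hp => hp.1 rfl⟩

/-- The union of a family of blocks. -/
def blockUnion {k : ℕ} (Z : Fin k → Finset (Fin n × Fin m)) : Finset (Fin n × Fin m) :=
  Finset.univ.biUnion Z

end Composition

/-- The three kinds of blocks. -/
inductive BlockKind : Type
  | singleton
  | xor
  | andOr

/-- The parameters of a solution: `k` row-disjoint and column-disjoint blocks, the outer function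
`h`, the signs of the dictators, the embedded functions `φ`, `γ` and the constants `B`, `D`, `κ`.
A block is a singleton or has no element that is alone both in its row and in its column. -/
structure SolutionData (n m k : ℕ) where
  Z : Fin k → Finset (Fin n × Fin m)
  nonempty : ∀ l, (Z l).Nonempty
  row_disjoint : ∀ l l', l ≠ l' → Disjoint (rows (Z l)) (rows (Z l'))
  col_disjoint : ∀ l l', l ≠ l' → Disjoint (cols (Z l)) (cols (Z l'))
  not_isolated : ∀ l, (Z l).card ≠ 1 → ∀ i j, (i, j) ∈ Z l →
    i ∈ rowsTwo (Z l) ∨ j ∈ colsTwo (Z l)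
  kind : Fin k → BlockKind
  kind_singleton : ∀ l, kind l = BlockKind.singleton ↔ (Z l).card = 1
  h : BoolFn (Fin k)
  sgnF : Fin m → ℤˣ
  sgnG : Fin n → ℤˣ
  φ : (j : Fin m) → Cube {i : Fin n // i ∈ colDepOne (blockUnion Z) j} → ℝ
  γ : (i : Fin n) → Cube {j : Fin m // j ∈ rowDepOne (blockUnion Z) i} → ℝ
  B : Fin m → ℝ
  D : Fin n → ℝ
  κ : Fin n → Fin m → ℝ
  B_eq_zero : ∀ j, j ∉ colsTwo (blockUnion Z) → B j = 0
  D_eq_zero : ∀ i, i ∉ rowsTwo (blockUnion Z) → D i = 0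
  κ_eq_zero : ∀ i j, ¬ ((i, j) ∈ blockUnion Z ∧ i ∈ rowsTwo (blockUnion Z) ∧
    j ∈ colsTwo (blockUnion Z)) → κ i j = 0
  xor_col : ∀ l, kind l = BlockKind.xor → ∀ j ∈ cols (Z l),
    B j = 0 ∧ ∀ u, φ j u = 1 ∨ φ j u = -1
  xor_row : ∀ l, kind l = BlockKind.xor → ∀ i ∈ rows (Z l),
    D i = 0 ∧ ∀ v, γ i v = 1 ∨ γ i v = -1
  xor_shift : ∀ l, kind l = BlockKind.xor → ∀ i j, (i, j) ∈ Z l → κ i j = 0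
  xor_sgnF : ∀ l, kind l = BlockKind.xor → ∀ j ∈ colsOne (Z l), ∀ u, φ j u = val (sgnF j)
  xor_sgnG : ∀ l, kind l = BlockKind.xor → ∀ i ∈ rowsOne (Z l), ∀ v, γ i v = val (sgnG i)
  andOr_col : ∀ l, kind l = BlockKind.andOr → ∀ j ∈ colsTwo (Z l),
    (B j = 1 ∨ B j = -1) ∧ ∀ u, φ j u = 0 ∨ φ j u = 1
  andOr_row : ∀ l, kind l = BlockKind.andOr → ∀ i ∈ rowsTwo (Z l),
    (D i = 1 ∨ D i = -1) ∧ ∀ v, γ i v = 0 ∨ γ i v = 1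
  andOr_shift : ∀ l, kind l = BlockKind.andOr → ∀ i j, (i, j) ∈ Z l →
    i ∈ rowsTwo (Z l) → j ∈ colsTwo (Z l) → κ i j = 1 ∨ κ i j = -1

namespace SolutionData

variable {n m k : ℕ} (S : SolutionData n m k)

/-- The set of all matrix positions that lie in a block. -/
def Z₀ : Finset (Fin n × Fin m) := blockUnion S.Z

/-- The embedded function of column `j` applied to the restriction of `x`. -/
def phiAt (j : Fin m) (x : Cube (Fin n)) : ℝ := S.φ j fun i => x i.1

/-- The embedded function of row `i` applied to the restriction of `y`. -/
def gammaAt (i : Fin n) (y : Cube (Fin m)) : ℝ := S.γ i fun j => y j.1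

/-- The vector `x` with the entries of one-element rows multiplied by the sign of the dictator. -/
def xSgn (x : Cube (Fin n)) : Cube (Fin n) :=
  fun i => if i ∈ rowsOne S.Z₀ then S.sgnG i * x i else x i

/-- The vector `y` with the entries of one-element columns multiplied by the sign of the
dictator. -/
def ySgn (y : Cube (Fin m)) : Cube (Fin m) :=
  fun j => if j ∈ colsOne S.Z₀ then S.sgnF j * y j else y j

/-- The formulas in a singleton block. -/
def SingletonForm (l : Fin k) (f : Fin m → BoolFn (Fin n)) (g : Fin n → BoolFn (Fin m))
    (F : BoolFn (Fin n)) (G : BoolFn (Fin m)) : Prop :=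
  ∀ i j, (i, j) ∈ S.Z l →
    (∀ x, f j x = S.sgnF j * x i) ∧ (∀ y, g i y = S.sgnG i * y j) ∧
    (∀ x, F x = S.sgnF j * x i) ∧ (∀ y, G y = S.sgnG i * y j)

/-- The formulas in an XOR-like block. -/
def XorForm (l : Fin k) (f : Fin m → BoolFn (Fin n)) (g : Fin n → BoolFn (Fin m))
    (F : BoolFn (Fin n)) (G : BoolFn (Fin m)) : Prop :=
  (∀ j ∈ cols (S.Z l), ∀ x, val (f j x) = S.phiAt j x * ∏ i ∈ colDepTwo S.Z₀ j, val (x i)) ∧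
  (∀ i ∈ rows (S.Z l), ∀ y, val (g i y) = S.gammaAt i y * ∏ j ∈ rowDepTwo S.Z₀ i, val (y j)) ∧
  (∀ x, val (F x) =
    (∏ i ∈ rowsTwo (S.Z l), val (x i)) * ∏ j ∈ colsTwo (S.Z l), S.phiAt j (S.xSgn x)) ∧
  (∀ y, val (G y) =
    (∏ j ∈ colsTwo (S.Z l), val (y j)) * ∏ i ∈ rowsTwo (S.Z l), S.gammaAt i (S.ySgn y))

/-- The formulas in an AND/OR-like block. -/
def AndOrForm (l : Fin k) (f : Fin m → BoolFn (Fin n)) (g : Fin n → BoolFn (Fin m))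
    (F : BoolFn (Fin n)) (G : BoolFn (Fin m)) : Prop :=
  (∀ i j, (i, j) ∈ S.Z l → j ∈ colsOne (S.Z l) → ∀ x, f j x = S.sgnF j * x i) ∧
  (∀ i j, (i, j) ∈ S.Z l → i ∈ rowsOne (S.Z l) → ∀ y, g i y = S.sgnG i * y j) ∧
  (∀ j ∈ colsTwo (S.Z l), ∀ x, val (f j x) =
    S.phiAt j x * (2 * S.B j) * (∏ i ∈ colDepTwo S.Z₀ j, (S.κ i j * val (x i) + 1) / 2)
      - S.B j) ∧
  (∀ i ∈ rowsTwo (S.Z l), ∀ y, val (g i y) =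
    S.gammaAt i y * (2 * S.D i) * (∏ j ∈ rowDepTwo S.Z₀ i, (S.κ i j * val (y j) + 1) / 2)
      - S.D i) ∧
  (∀ x, val (F x) =
    2 * (∏ i ∈ rowsTwo (S.Z l), (S.D i * val (x i) + 1) / 2) *
      (∏ j ∈ colsTwo (S.Z l), S.phiAt j (S.xSgn x)) - 1) ∧
  (∀ y, val (G y) =
    2 * (∏ j ∈ colsTwo (S.Z l), (S.B j * val (y j) + 1) / 2) *
      (∏ i ∈ rowsTwo (S.Z l), S.gammaAt i (S.ySgn y)) - 1)

/-- The formulas in the block `l`, according to its kind. -/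
def BlockForm (l : Fin k) (f : Fin m → BoolFn (Fin n)) (g : Fin n → BoolFn (Fin m))
    (F : BoolFn (Fin n)) (G : BoolFn (Fin m)) : Prop :=
  match S.kind l with
  | BlockKind.singleton => S.SingletonForm l f g F G
  | BlockKind.xor => S.XorForm l f g F G
  | BlockKind.andOr => S.AndOrForm l f g F G

/-- The functions `f₀, f, g₀, g` are given by the parameters `S`, where `F l` and `G l` are the
inner functions of `f₀` and `g₀` for the block `l`. -/
def HasForm (f₀ : BoolFn (Fin n)) (f : Fin m → BoolFn (Fin n))
    (g₀ : BoolFn (Fin m)) (g : Fin n → BoolFn (Fin m)) : Prop :=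
  ∃ (F : Fin k → BoolFn (Fin n)) (G : Fin k → BoolFn (Fin m)),
    (∀ x, f₀ x = S.h fun l => F l x) ∧ (∀ y, g₀ y = S.h fun l => G l y) ∧
    ∀ l, S.BlockForm l f g (F l) (G l)

end SolutionData

end GenPoly

/-!
Write `Φ` for the common composition `f₀ ∘ g = g₀ ∘ f`.

The converse direction is a computation. In the inner function `F l` of a block, the signs in
`x^sgn` undo the signs of the dictators (`phiAt_xSgn_rowVals`), so that `F l ∘ g` and `G l ∘ f`
expand to one expression that is symmetric in rows and columns (`outer_rowVals_eq_outer_colVals`).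
Transposing the matrix (`SolutionData.transpose`) makes statements about rows into statements about
columns.

The direct part rests on the sensitivity of `Φ` at a position `(i, j)`. It factors into a condition
on row `i` and a condition on the values of the other row functions, and likewise for columns.
Hence, if flipping the `i'`-th input of `f j` destroys the sensitivity of `f j` at `i`, the value
of `g i'` must be forced by its `j`-th input: `j` is canalizing for `g i'`
(`IsGeneralizedPolymorphism.exists_canalizes`). It follows that in a row with at least two relevant
positions either `i` is canalizing for all column functions that depend on it or all of these are
odd at `i`, that is, `i` enters as a factor (`IsReduced.oddAt_of_not_canalizingRow`), and that the
first alternative spreads along rows and columns through the whole component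
(`IsReduced.canalizingRow_transpose`).
Canalizing inputs give the AND/OR formulas and odd inputs the XOR formulas
(`SolutionData.colForm_of_isReduced`).

It remains to see that `f₀` depends on a block only through `F l` (`rowComp_eq_of_outer_eq`). In an
XOR-like block, flipping the input of `f₀` at any row and the input of `g₀` at any column with at
least two elements has the same effect on `Φ`, because this holds for a row and a column that meet
in a position and the block is connected. In an AND/OR-like block the same argument
applies to setting an input to its canalized value. Replacing a matrix by another one block by block
then shows that `f₀` factors through the functions `F l`, which gives `h`; the block identity and the
surjectivity of the column values transfer the factorization to `g₀`.

The statements on degrees reduce, by Fourier inversion, to the fact that a Boolean function of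
degree at most one depends on at most one coordinate (`card_dep_le_one_of_degree_le_one`).
-/

namespace GenPoly

/-! ### Signs -/

lemma val_mul (s t : ℤˣ) : val (s * t) = val s * val t := by simp [val]

lemma val_one : val 1 = 1 := by simp [val]

lemma val_neg (s : ℤˣ) : val (-s) = -val s := by simp [val]

lemma val_eq_one_or (s : ℤˣ) : val s = 1 ∨ val s = -1 := by
  rcases Int.units_eq_one_or s with rfl | rfl <;> simp [val]

lemma val_mul_self (s : ℤˣ) : val s * val s = 1 := by
  rcases val_eq_one_or s with h | h <;> simp [h]

lemma val_injective : Function.Injective val := by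
  intro s t h
  exact Units.ext (Int.cast_injective (α := ℝ) h)

lemma exists_val_eq {r : ℝ} (h : r = 1 ∨ r = -1) : ∃ s : ℤˣ, val s = r := by
  rcases h with rfl | rfl
  · exact ⟨1, val_one⟩
  · exact ⟨-1, by rw [val_neg, val_one]⟩

/-- The sign with the same value as a real number `1` or `-1`. -/
noncomputable def toSign (r : ℝ) : ℤˣ := if r = 1 then 1 else -1

lemma val_toSign {r : ℝ} (hr : r = 1 ∨ r = -1) : val (toSign r) = r := by
  rcases hr with rfl | rfl
  · simp [toSign, val]
  · rw [toSign, if_neg (by norm_num), val_neg, val_one]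

lemma mul_neg_toSign {r : ℝ} (hr : r = 1 ∨ r = -1) : (r * val (-toSign r) + 1) / 2 = 0 := by
  rw [val_neg, val_toSign hr]
  rcases hr with rfl | rfl <;> norm_num

lemma mul_toSign {r : ℝ} (hr : r = 1 ∨ r = -1) : (r * val (toSign r) + 1) / 2 = 1 := by
  rw [val_toSign hr]
  rcases hr with rfl | rfl <;> norm_num

lemma NonConstant.exists_eq {ι : Type} {f : BoolFn ι} (hf : NonConstant f) (s : ℤˣ) :
    ∃ x, f x = s := by
  by_contra! h
  exact hf ⟨-s, fun x => Int.units_ne_iff_eq_neg.1 (h x)⟩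

/-- Every value of the `i`-th coordinate other than `κ` fixes the value of `f` to be `-c`: the
coordinate `i` is canalizing for `f`. -/
def Canalizes {ι : Type} (f : BoolFn ι) (i : ι) (κ c : ℤˣ) : Prop := ∀ x, x i = -κ → f x = -c

lemma Canalizes.eq_of_apply {ι : Type} {f : BoolFn ι} {i : ι} {κ c : ℤˣ} (h : Canalizes f i κ c)
    {x : Cube ι} (hx : f x = c) : x i = κ := by
  by_contra hne
  have h1 := h x (Int.units_ne_iff_eq_neg.1 hne)
  rw [hx] at h1
  exact units_ne_neg_self c h1

/-! ### Flipping coordinates -/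

section Flip

variable {ι : Type} [DecidableEq ι]

/-- The vector `x` with the sign of its `i`-th coordinate reversed. -/
def flip (i : ι) (x : Cube ι) : Cube ι := Function.update x i (-x i)

lemma flip_same (i : ι) (x : Cube ι) : flip i x i = -x i := by simp [flip]

lemma flip_ne {i k : ι} (h : k ≠ i) (x : Cube ι) : flip i x k = x k := by simp [flip, h]

lemma flip_flip (i : ι) (x : Cube ι) : flip i (flip i x) = x := by
  simp [flip]

lemma flip_comm (i k : ι) (x : Cube ι) : flip i (flip k x) = flip k (flip i x) := by
  ext l
  by_cases hi : l = i <;> by_cases hk : l = k <;> simp [flip, Function.update_apply] <;> grind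

lemma update_eq_or_flip (i : ι) (x : Cube ι) (s : ℤˣ) :
    Function.update x i s = x ∨ Function.update x i s = flip i x := by
  by_cases h : s = x i
  · left; simp [h]
  · right; rw [flip, Int.units_ne_iff_eq_neg.1 h]

lemma eq_or_eq_flip {i : ι} {x y : Cube ι} (h : ∀ k, k ≠ i → x k = y k) : x = y ∨ x = flip i y := by
  have hx : x = Function.update y i (x i) := by
    ext k
    by_cases hk : k = i
    · subst hk; simp
    · simp [hk, h k hk]
  rw [hx]
  exact update_eq_or_flip i y _

lemma prod_val_flip {s : Finset ι} {i : ι} (hi : i ∈ s) (x : Cube ι) :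
    ∏ k ∈ s, val (flip i x k) = -∏ k ∈ s, val (x k) := by
  rw [← Finset.mul_prod_erase s (fun k => val (x k)) hi,
    ← Finset.mul_prod_erase s (fun k => val (flip i x k)) hi,
    flip_same, val_neg, neg_mul, Finset.prod_congr rfl fun k hk => congrArg val
      (flip_ne (Finset.ne_of_mem_erase hk) x)]

lemma prod_val_flip_of_notMem {s : Finset ι} {i : ι} (hi : i ∉ s) (x : Cube ι) :
    ∏ k ∈ s, val (flip i x k) = ∏ k ∈ s, val (x k) :=
  Finset.prod_congr rfl fun k hk => by rw [flip_ne (fun e : k = i => hi (e ▸ hk))]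

/-- The value of `f` at `x` changes when the `i`-th coordinate is flipped. -/
def SensAt (f : BoolFn ι) (i : ι) (x : Cube ι) : Prop := f (flip i x) ≠ f x

lemma SensAt.flip_eq {f : BoolFn ι} {i : ι} {x : Cube ι} (h : SensAt f i x) :
    f (flip i x) = -f x := Int.units_ne_iff_eq_neg.1 h

lemma not_sensAt {f : BoolFn ι} {i : ι} {x : Cube ι} : ¬ SensAt f i x ↔ f (flip i x) = f x :=
  not_not

lemma sensAt_flip_self {f : BoolFn ι} {i : ι} {x : Cube ι} :
    SensAt f i (flip i x) ↔ SensAt f i x := by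
  simp only [SensAt, flip_flip]
  exact ne_comm

lemma sensAt_congr {f : BoolFn ι} {i : ι} {x y : Cube ι} (h : ∀ k, k ≠ i → x k = y k) :
    SensAt f i x ↔ SensAt f i y := by
  rcases eq_or_eq_flip h with rfl | rfl
  · rfl
  · exact sensAt_flip_self

/-- A map that does not change under flips of the coordinates in `T` only sees the coordinates
outside `T`. -/
lemma eq_of_flip_invariant {α : Type*} (h : Cube ι → α) (T : Finset ι)
    (hT : ∀ i ∈ T, ∀ x, h (flip i x) = h x) {x y : Cube ι} (hxy : ∀ i, i ∉ T → x i = y i) :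
    h x = h y := by
  induction T using Finset.induction_on generalizing x with
  | empty => exact congrArg h (funext fun i => hxy i (by simp))
  | insert a T ha ih =>
    have h1 : h (Function.update x a (y a)) = h x := by
      rcases update_eq_or_flip a x (y a) with e | e <;> rw [e]
      exact hT a (by simp) x
    rw [← h1]
    refine ih (fun i hi => hT i (by simp [hi])) fun i hi => ?_
    by_cases hia : i = a
    · subst hia; simp
    · simp [hia, hxy i (by simp [hia, hi])]

/-- `f` is the product of the `i`-th coordinate and a function of the other coordinates. -/
def OddAt (f : BoolFn ι) (i : ι) : Prop := ∀ x, f (flip i x) = -f x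

/-- Joint sensitivity is symmetric: if flipping `k` destroys the sensitivity of `f` at `i`
somewhere, then flipping `i` destroys the sensitivity at `k` somewhere, possibly elsewhere. -/
lemma exists_sensAt_flip_symm {f : BoolFn ι} {i k : ι} {x : Cube ι} (hx : SensAt f i x)
    (hx' : ¬ SensAt f i (flip k x)) : ∃ y, SensAt f k y ∧ ¬ SensAt f k (flip i y) := by
  rw [not_sensAt, flip_comm] at hx'
  have h1 := hx.flip_eq
  by_cases h : SensAt f k x
  · refine ⟨x, h, ?_⟩
    rw [not_sensAt, hx', h1, h.flip_eq]
  · refine ⟨flip i x, ?_, by rwa [flip_flip]⟩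
    rw [SensAt, hx', h1, not_sensAt.1 h]
    exact units_ne_neg_self _

variable [Fintype ι]

lemma mem_dep {f : BoolFn ι} {i : ι} : i ∈ dep f ↔ ∃ x, SensAt f i x := by
  simp only [dep, Finset.mem_filter, Finset.mem_univ, true_and]
  constructor
  · rintro ⟨x, hx⟩
    refine ⟨Function.update x i 1, ?_⟩
    simpa [SensAt, flip] using hx.symm
  · rintro ⟨x, hx⟩
    refine ⟨x, ?_⟩
    rcases Int.units_eq_one_or (x i) with h | h
    · have h1 : Function.update x i 1 = x := by rw [← h]; simp
      have h2 : Function.update x i (-1) = flip i x := by rw [flip, h]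
      rw [h1, h2]; exact hx.symm
    · have h1 : Function.update x i (-1) = x := by rw [← h]; simp
      have h2 : Function.update x i 1 = flip i x := by rw [flip, h]; simp
      rw [h1, h2]; exact hx

lemma apply_flip_of_notMem_dep {f : BoolFn ι} {i : ι} (h : i ∉ dep f) (x : Cube ι) :
    f (flip i x) = f x := by
  by_contra hx
  exact h (mem_dep.2 ⟨x, hx⟩)

lemma apply_congr_dep {f : BoolFn ι} {x y : Cube ι} (h : ∀ i ∈ dep f, x i = y i) : f x = f y :=
  eq_of_flip_invariant f (dep f)ᶜ
    (fun _ hi x => apply_flip_of_notMem_dep (Finset.mem_compl.1 hi) x)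
    fun i hi => h i (by simpa using hi)

lemma NonConstant.dep_nonempty {f : BoolFn ι} (hf : NonConstant f) : (dep f).Nonempty := by
  rw [Finset.nonempty_iff_ne_empty]
  intro h
  exact hf ⟨f 1, fun x => apply_congr_dep (by simp [h])⟩

/-- A function of a single coordinate is a dictator, with the sign given by its value at the
vector `1`. -/
lemma NonConstant.eq_mul_of_dep_eq_singleton {f : BoolFn ι} (hf : NonConstant f) {i : ι}
    (h : dep f = {i}) (x : Cube ι) : f x = f 1 * x i := by
  have key : ∀ y : Cube ι, y i = x i → f y = f x := fun y hy =>
    apply_congr_dep (by simp [h, hy])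
  rcases Int.units_eq_one_or (x i) with hx | hx
  · rw [hx, mul_one, ← key 1 (by simp [hx])]
  · rw [hx, mul_neg_one, ← Int.units_ne_iff_eq_neg]
    intro he
    refine hf ⟨f x, fun y => ?_⟩
    rcases Int.units_eq_one_or (y i) with hy | hy
    · rw [he]; exact apply_congr_dep (by simp [h, hy])
    · exact key y (by rw [hx, hy])

/-- If the sensitivity of `f` at `i` is not affected by the other coordinates, then `f` is odd
at `i`. -/
lemma oddAt_of_sensAt_flip {f : BoolFn ι} {i : ι} (hi : i ∈ dep f)
    (h : ∀ k, k ≠ i → ∀ x, SensAt f i x → SensAt f i (flip k x)) : OddAt f i := by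
  obtain ⟨x₀, hx₀⟩ := mem_dep.1 hi
  intro x
  have h1 : SensAt f i x₀ = SensAt f i x := by
    refine eq_of_flip_invariant (SensAt f i) Finset.univ (fun k _ y => propext ?_) (by simp)
    by_cases hk : k = i
    · subst hk; exact sensAt_flip_self
    · refine ⟨fun hy => ?_, h k hk y⟩
      simpa [flip_flip] using h k hk _ hy
  exact (h1 ▸ hx₀ : SensAt f i x).flip_eq

/-- A function with a canalizing coordinate `k` is sensitive to any other relevant coordinate only
while `k` does not take its canalizing value. -/
lemma Canalizes.exists_sensAt {f : BoolFn ι} {i k : ι} {κ c : ℤˣ} (h : Canalizes f k κ c)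
    (hki : k ≠ i) (hi : i ∈ dep f) :
    ∃ x, x k = κ ∧ SensAt f i x ∧ ¬ SensAt f i (flip k x) := by
  obtain ⟨x, hx⟩ := mem_dep.1 hi
  have hk : x k = κ := by
    by_contra hne
    have hne := Int.units_ne_iff_eq_neg.1 hne
    exact hx (by rw [h x hne, h _ (by rw [flip_ne hki, hne])])
  refine ⟨x, hk, hx, ?_⟩
  rw [not_sensAt, h _ (by rw [flip_ne hki, flip_same, hk]), h _ (by rw [flip_same, hk])]

end Flip

/-! ### Degree -/

section Degree

lemma sum_prod_val_mul_val {ι : Type} [Fintype ι] (x y : Cube ι) :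
    ∑ s : Finset ι, (∏ i ∈ s, val (y i)) * ∏ i ∈ s, val (x i) =
      if y = x then 2 ^ Fintype.card ι else 0 := by
  classical
  have h1 : ∑ s : Finset ι, (∏ i ∈ s, val (y i)) * ∏ i ∈ s, val (x i) =
      ∏ i, (1 + val (y i) * val (x i)) := by
    rw [Finset.prod_one_add, Finset.powerset_univ]
    exact Finset.sum_congr rfl fun s _ => Finset.prod_mul_distrib.symm
  rw [h1]
  split_ifs with h
  · subst h
    simp [val_mul_self, one_add_one_eq_two]
  · obtain ⟨i, hi⟩ := Function.ne_iff.1 h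
    refine Finset.prod_eq_zero (Finset.mem_univ i) ?_
    rw [Int.units_ne_iff_eq_neg.1 hi, val_neg, neg_mul, val_mul_self, add_neg_cancel]

variable {ι : Type} [Fintype ι] [DecidableEq ι]

/-- Fourier inversion on the cube. -/
lemma val_eq_sum_fourierCoeff (f : BoolFn ι) (x : Cube ι) :
    val (f x) = ∑ s : Finset ι, fourierCoeff f s * ∏ i ∈ s, val (x i) := by
  have h2 : (2 : ℝ) ^ Fintype.card ι ≠ 0 := by positivity
  have : ∑ s : Finset ι, fourierCoeff f s * ∏ i ∈ s, val (x i) =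
      (∑ y : Cube ι, val (f y) *
        ∑ s : Finset ι, (∏ i ∈ s, val (y i)) * ∏ i ∈ s, val (x i)) / 2 ^ Fintype.card ι := by
    simp only [fourierCoeff, div_mul_eq_mul_div, ← Finset.sum_div, Finset.sum_mul, Finset.mul_sum]
    rw [Finset.sum_comm]
    simp only [mul_assoc]
  rw [this]
  simp [sum_prod_val_mul_val, h2]

lemma card_le_degree {f : BoolFn ι} {s : Finset ι} (hs : fourierCoeff f s ≠ 0) :
    s.card ≤ degree f := by
  classical
  exact Finset.le_sup (f := Finset.card) (by simpa using hs)

lemma fourierCoeff_eq_zero_of_notMem_dep {f : BoolFn ι} {s : Finset ι} {i : ι} (hi : i ∈ s)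
    (hf : i ∉ dep f) : fourierCoeff f s = 0 := by
  have h : ∑ x : Cube ι, val (f x) * ∏ k ∈ s, val (x k) =
      ∑ x : Cube ι, -(val (f x) * ∏ k ∈ s, val (x k)) := by
    refine Finset.sum_nbij' (flip i) (flip i) (by simp) (by simp) (fun x _ => flip_flip i x)
      (fun x _ => flip_flip i x) fun x _ => ?_
    rw [apply_flip_of_notMem_dep hf, prod_val_flip hi]
    ring
  rw [Finset.sum_neg_distrib] at h
  rw [fourierCoeff, show ∑ x : Cube ι, val (f x) * ∏ k ∈ s, val (x k) = 0 by linarith, zero_div]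

lemma degree_le_card_dep (f : BoolFn ι) : degree f ≤ (dep f).card := by
  classical
  refine Finset.sup_le fun s hs => Finset.card_le_card fun i hi => ?_
  by_contra h
  exact (by simpa using hs : fourierCoeff f s ≠ 0) (fourierCoeff_eq_zero_of_notMem_dep hi h)

/-- A sensitive coordinate of a Boolean function of degree at most one contributes `±1` to its
value, so two such coordinates cannot coexist. -/
lemma card_dep_le_one_of_degree_le_one {f : BoolFn ι} (hf : degree f ≤ 1) :
    (dep f).card ≤ 1 := by
  -- the discrete derivative does not depend on the point
  have key : ∀ i x, val (f x) - val (f (flip i x)) = 2 * fourierCoeff f {i} * val (x i) := by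
    intro i x
    rw [val_eq_sum_fourierCoeff f x, val_eq_sum_fourierCoeff f (flip i x),
      ← Finset.sum_sub_distrib, Finset.sum_eq_single {i}]
    · simp [flip_same, val_neg]; ring
    · intro s _ hs
      by_cases hc : fourierCoeff f s = 0
      · simp [hc]
      · have h1 := (card_le_degree hc).trans hf
        have hi : i ∉ s := fun hi => hs (by
          obtain ⟨a, ha⟩ := Finset.card_eq_one.1 (le_antisymm h1 (Finset.card_pos.2 ⟨i, hi⟩))
          subst ha
          rw [Finset.mem_singleton.1 hi])
        rw [prod_val_flip_of_notMem hi, sub_self]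
    · simp
  have odd : ∀ i ∈ dep f, OddAt f i := by
    intro i hi x
    obtain ⟨x₀, hx₀⟩ := mem_dep.1 hi
    have h0 : fourierCoeff f {i} ≠ 0 := by
      intro h
      have h1 := key i x₀
      rw [h] at h1
      exact hx₀ (val_injective (by linarith))
    refine Int.units_ne_iff_eq_neg.1 fun he => h0 ?_
    have h1 := key i x
    rw [he, sub_self] at h1
    rcases val_eq_one_or (x i) with hx | hx <;> rw [hx] at h1 <;> linarith
  by_contra! hcard
  obtain ⟨i, hi, k, hk, hik⟩ := Finset.one_lt_card.1 hcard
  have h1 := key i 1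
  have h2 := key i (flip k 1)
  rw [odd k hk, flip_comm, odd k hk, val_neg, val_neg, flip_ne hik] at h2
  have h3 : val (f (flip i 1)) = -val (f 1) := by rw [odd i hi, val_neg]
  rcases val_eq_one_or (f 1) with h | h <;> rw [h3, h] at h1 h2 <;> linarith

lemma degree_eq_one_iff {f : BoolFn ι} (hf : NonConstant f) :
    degree f = 1 ↔ (dep f).card = 1 := by
  have h1 := hf.dep_nonempty.card_pos
  have h2 := degree_le_card_dep f
  constructor
  · intro h
    have := card_dep_le_one_of_degree_le_one h.le
    omega
  · intro h
    refine le_antisymm (h ▸ h2) (Nat.one_le_iff_ne_zero.2 fun h0 => ?_)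
    -- a function of degree zero is constant
    refine hf ⟨f 1, fun x => val_injective ?_⟩
    rw [val_eq_sum_fourierCoeff f x, val_eq_sum_fourierCoeff f 1]
    refine Finset.sum_congr rfl fun s _ => ?_
    by_cases hc : fourierCoeff f s = 0
    · simp [hc]
    · have h3 := card_le_degree hc
      rw [h0, Nat.le_zero, Finset.card_eq_zero] at h3
      simp [h3]

lemma two_le_degree_iff {f : BoolFn ι} (hf : NonConstant f) :
    2 ≤ degree f ↔ 2 ≤ (dep f).card := by
  have h1 := hf.dep_nonempty.card_pos
  have h2 := degree_le_card_dep f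
  have h3 := degree_eq_one_iff hf
  have h4 := fun h => card_dep_le_one_of_degree_le_one (f := f) h
  omega

end Degree

/-! ### Rows, columns and transposition -/

section Positions

variable {n m k : ℕ} {W : Finset (Fin n × Fin m)} {i : Fin n} {j : Fin m}

lemma mem_rowEntries : j ∈ rowEntries W i ↔ (i, j) ∈ W := by simp [rowEntries]

lemma mem_colEntries : i ∈ colEntries W j ↔ (i, j) ∈ W := by simp [colEntries]

lemma mem_rows : i ∈ rows W ↔ ∃ j, (i, j) ∈ W := by simp [rows]

lemma mem_cols : j ∈ cols W ↔ ∃ i, (i, j) ∈ W := by simp [cols]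

lemma mem_rowsOne : i ∈ rowsOne W ↔ (rowEntries W i).card = 1 := by simp [rowsOne]

lemma mem_rowsTwo : i ∈ rowsTwo W ↔ 2 ≤ (rowEntries W i).card := by simp [rowsTwo]

lemma mem_colsOne : j ∈ colsOne W ↔ (colEntries W j).card = 1 := by simp [colsOne]

lemma mem_colsTwo : j ∈ colsTwo W ↔ 2 ≤ (colEntries W j).card := by simp [colsTwo]

lemma mem_rowDepOne : j ∈ rowDepOne W i ↔ (i, j) ∈ W ∧ j ∈ colsOne W := by
  simp [rowDepOne, mem_rowEntries]

lemma mem_rowDepTwo : j ∈ rowDepTwo W i ↔ (i, j) ∈ W ∧ j ∈ colsTwo W := by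
  simp [rowDepTwo, mem_rowEntries]

lemma mem_colDepOne : i ∈ colDepOne W j ↔ (i, j) ∈ W ∧ i ∈ rowsOne W := by
  simp [colDepOne, mem_colEntries]

lemma mem_colDepTwo : i ∈ colDepTwo W j ↔ (i, j) ∈ W ∧ i ∈ rowsTwo W := by
  simp [colDepTwo, mem_colEntries]

lemma rowsTwo_subset_rows : rowsTwo W ⊆ rows W := fun i hi => by
  obtain ⟨j, hj⟩ := Finset.card_pos.1 (show 0 < (rowEntries W i).card by
    have := mem_rowsTwo.1 hi; omega)
  exact mem_rows.2 ⟨j, mem_rowEntries.1 hj⟩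

lemma rowsOne_or_rowsTwo (h : (i, j) ∈ W) : i ∈ rowsOne W ∨ i ∈ rowsTwo W := by
  have := Finset.card_pos.2 ⟨j, mem_rowEntries.2 h⟩
  rw [mem_rowsOne, mem_rowsTwo]
  omega

lemma notMem_rowsTwo_of_rowsOne (h : i ∈ rowsOne W) : i ∉ rowsTwo W := by
  rw [mem_rowsOne] at h
  rw [mem_rowsTwo]
  omega

lemma rowEntries_of_rowsOne (h : (i, j) ∈ W) (hi : i ∈ rowsOne W) : rowEntries W i = {j} := by
  obtain ⟨a, ha⟩ := Finset.card_eq_one.1 (mem_rowsOne.1 hi)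
  have hj := mem_rowEntries.2 h
  rw [ha, Finset.mem_singleton] at hj
  rw [ha, hj]

/-- The set of matrix positions obtained from `W` by transposing the matrix. -/
def transposeSet (W : Finset (Fin n × Fin m)) : Finset (Fin m × Fin n) :=
  W.map (Equiv.prodComm (Fin n) (Fin m)).toEmbedding

lemma mem_transposeSet : (j, i) ∈ transposeSet W ↔ (i, j) ∈ W := by
  simp [transposeSet]

lemma card_transposeSet : (transposeSet W).card = W.card := Finset.card_map _

lemma rowEntries_transposeSet : rowEntries (transposeSet W) j = colEntries W j := by
  ext i; rw [mem_rowEntries, mem_colEntries, mem_transposeSet]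

lemma colEntries_transposeSet : colEntries (transposeSet W) i = rowEntries W i := by
  ext j; rw [mem_rowEntries, mem_colEntries, mem_transposeSet]

lemma rows_transposeSet : rows (transposeSet W) = cols W := by
  ext j; simp only [mem_rows, mem_cols, mem_transposeSet]

lemma cols_transposeSet : cols (transposeSet W) = rows W := by
  ext j; simp only [mem_rows, mem_cols, mem_transposeSet]

lemma rowsOne_transposeSet : rowsOne (transposeSet W) = colsOne W := by
  ext j; rw [mem_rowsOne, mem_colsOne, rowEntries_transposeSet]

lemma rowsTwo_transposeSet : rowsTwo (transposeSet W) = colsTwo W := by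
  ext j; rw [mem_rowsTwo, mem_colsTwo, rowEntries_transposeSet]

lemma colsOne_transposeSet : colsOne (transposeSet W) = rowsOne W := by
  ext j; rw [mem_rowsOne, mem_colsOne, colEntries_transposeSet]

lemma colsTwo_transposeSet : colsTwo (transposeSet W) = rowsTwo W := by
  ext j; rw [mem_rowsTwo, mem_colsTwo, colEntries_transposeSet]

lemma rowDepOne_transposeSet : rowDepOne (transposeSet W) j = colDepOne W j := by
  ext i; rw [mem_rowDepOne, mem_colDepOne, mem_transposeSet, colsOne_transposeSet]

lemma rowDepTwo_transposeSet : rowDepTwo (transposeSet W) j = colDepTwo W j := by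
  ext i; rw [mem_rowDepTwo, mem_colDepTwo, mem_transposeSet, colsTwo_transposeSet]

lemma colDepOne_transposeSet : colDepOne (transposeSet W) i = rowDepOne W i := by
  ext i; rw [mem_rowDepOne, mem_colDepOne, mem_transposeSet, rowsOne_transposeSet]

lemma colDepTwo_transposeSet : colDepTwo (transposeSet W) i = rowDepTwo W i := by
  ext i; rw [mem_rowDepTwo, mem_colDepTwo, mem_transposeSet, rowsTwo_transposeSet]

lemma blockUnion_transposeSet (Z : Fin k → Finset (Fin n × Fin m)) :
    (blockUnion fun l => transposeSet (Z l)) = transposeSet (blockUnion Z) := by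
  ext ⟨j, i⟩; simp [blockUnion, mem_transposeSet]

lemma colsTwo_subset_cols : colsTwo W ⊆ cols W := by
  simpa only [rowsTwo_transposeSet, rows_transposeSet] using
    rowsTwo_subset_rows (W := transposeSet W)

lemma colsOne_subset_cols : colsOne W ⊆ cols W := fun j hj => by
  obtain ⟨i, hi⟩ := Finset.card_pos.1 (show 0 < (colEntries W j).card by
    have := mem_colsOne.1 hj; omega)
  exact mem_cols.2 ⟨i, mem_colEntries.1 hi⟩

lemma colsOne_or_colsTwo (h : (i, j) ∈ W) : j ∈ colsOne W ∨ j ∈ colsTwo W := by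
  simpa only [rowsTwo_transposeSet, rowsOne_transposeSet] using
    rowsOne_or_rowsTwo (mem_transposeSet.2 h)

lemma notMem_colsTwo_of_colsOne (h : j ∈ colsOne W) : j ∉ colsTwo W := by
  rw [← rowsTwo_transposeSet]
  exact notMem_rowsTwo_of_rowsOne (by rwa [rowsOne_transposeSet])

lemma colEntries_of_colsOne (h : (i, j) ∈ W) (hj : j ∈ colsOne W) : colEntries W j = {i} := by
  rw [← rowEntries_transposeSet]
  exact rowEntries_of_rowsOne (mem_transposeSet.2 h) (by rwa [rowsOne_transposeSet])

/-- A property of positions that spreads along the rows and the columns with at least two elements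
spreads along paths. -/
lemma reachable_induction {C : Fin n × Fin m → Prop}
    (hrow : ∀ i j j', (i, j) ∈ W → (i, j') ∈ W → i ∈ rowsTwo W → C (i, j) → C (i, j'))
    (hcol : ∀ i i' j, (i, j) ∈ W → (i', j) ∈ W → j ∈ colsTwo W → C (i, j) → C (i', j))
    {p q : {p : Fin n × Fin m // p ∈ W}} (hpq : (entryGraph W).Reachable p q) (hp : C p.1) :
    C q.1 := by
  obtain ⟨w⟩ := hpq
  induction w with
  | nil => exact hp
  | @cons a b c hadj _ ih =>
    obtain ⟨⟨i, j⟩, ha⟩ := a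
    obtain ⟨⟨i', j'⟩, hb⟩ := b
    obtain ⟨hne, h | h⟩ := hadj <;> dsimp only at h <;> subst h
    · refine ih (hrow i j j' ha hb (mem_rowsTwo.2 ?_) hp)
      exact Finset.one_lt_card.2 ⟨j, mem_rowEntries.2 ha, j', mem_rowEntries.2 hb, fun e =>
        hne (by subst e; rfl)⟩
    · refine ih (hcol i i' j ha hb (mem_colsTwo.2 ?_) hp)
      exact Finset.one_lt_card.2 ⟨i, mem_colEntries.2 ha, i', mem_colEntries.2 hb, fun e =>
        hne (by subst e; rfl)⟩

open Classical in
/-- The vertex sets of the connected components of the graph of positions form blocks. -/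
lemma exists_blocks (W : Finset (Fin n × Fin m)) :
    ∃ (k : ℕ) (Z : Fin k → Finset (Fin n × Fin m)), (∀ l, (Z l).Nonempty) ∧
      (∀ l l', l ≠ l' → Disjoint (rows (Z l)) (rows (Z l'))) ∧
      (∀ l l', l ≠ l' → Disjoint (cols (Z l)) (cols (Z l'))) ∧ blockUnion Z = W ∧
      ∀ p q : {p : Fin n × Fin m // p ∈ W},
        (∃ l, p.1 ∈ Z l ∧ q.1 ∈ Z l) ↔ (entryGraph W).Reachable p q := by
  have : Fintype (entryGraph W).ConnectedComponent := Fintype.ofFinite _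
  let e := Fintype.equivFin (entryGraph W).ConnectedComponent
  let Z : Fin (Fintype.card (entryGraph W).ConnectedComponent) → Finset (Fin n × Fin m) :=
    fun l => Finset.univ.filter fun p =>
      ∃ h : p ∈ W, e ((entryGraph W).connectedComponentMk ⟨p, h⟩) = l
  have hZ : ∀ l p, p ∈ Z l ↔ ∃ h : p ∈ W, e ((entryGraph W).connectedComponentMk ⟨p, h⟩) = l :=
    fun l p => by simp [Z]
  -- positions sharing a row or a column lie in the same component
  have hadj : ∀ l l' (p q : Fin n × Fin m), p ∈ Z l → q ∈ Z l' → (p.1 = q.1 ∨ p.2 = q.2) →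
      l = l' := by
    intro l l' p q hp hq hpq
    obtain ⟨hp, rfl⟩ := (hZ l p).1 hp
    obtain ⟨hq, rfl⟩ := (hZ l' q).1 hq
    by_cases hne : p = q
    · subst hne; rfl
    · refine congrArg e (SimpleGraph.ConnectedComponent.eq.2 (SimpleGraph.Adj.reachable ?_))
      exact ⟨fun h => hne (congrArg Subtype.val h), hpq⟩
  refine ⟨_, Z, fun l => ?_, fun l l' hll => ?_, fun l l' hll => ?_, ?_, fun p q => ?_⟩
  · obtain ⟨p, hp⟩ := (e.symm l).exists_rep
    refine ⟨p.1, (hZ l _).2 ⟨p.2, ?_⟩⟩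
    rw [← e.apply_symm_apply l, ← hp]
    rfl
  · refine Finset.disjoint_left.2 fun i hi hi' => ?_
    obtain ⟨j, hj⟩ := mem_rows.1 hi
    obtain ⟨j', hj'⟩ := mem_rows.1 hi'
    exact hll (hadj l l' _ _ hj hj' (Or.inl rfl))
  · refine Finset.disjoint_left.2 fun j hj hj' => ?_
    obtain ⟨i, hi⟩ := mem_cols.1 hj
    obtain ⟨i', hi'⟩ := mem_cols.1 hj'
    exact hll (hadj l l' _ _ hi hi' (Or.inr rfl))
  · ext p
    simp only [blockUnion, Finset.mem_biUnion, Finset.mem_univ, true_and, hZ]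
    exact ⟨fun ⟨_, h, _⟩ => h, fun h => ⟨_, h, rfl⟩⟩
  · rw [← SimpleGraph.ConnectedComponent.eq]
    constructor
    · rintro ⟨l, hp, hq⟩
      obtain ⟨_, hp⟩ := (hZ l _).1 hp
      obtain ⟨_, hq⟩ := (hZ l _).1 hq
      exact e.injective (hp.trans hq.symm)
    · intro h
      exact ⟨_, (hZ _ _).2 ⟨p.2, rfl⟩, (hZ _ _).2 ⟨q.2, congrArg e h.symm⟩⟩

/-- In a component with more than one element, no element is alone both in its row and in its
column. -/
lemma mem_rowsTwo_or_mem_colsTwo_of_reachable {p q : {p : Fin n × Fin m // p ∈ W}}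
    (hpq : (entryGraph W).Reachable p q) (hne : p ≠ q) :
    p.1.1 ∈ rowsTwo W ∨ p.1.2 ∈ colsTwo W := by
  by_contra! h
  refine hne (Subtype.ext (Eq.symm (reachable_induction (C := fun r => r = p.1) ?_ ?_ hpq rfl)))
  · intro i j j' _ _ hi hp
    exact absurd (hp ▸ hi) h.1
  · intro i i' j _ _ hj hp
    exact absurd (hp ▸ hj) h.2

end Positions

/-! ### Composing with the inner functions -/

section Vals

variable {n m : ℕ}

/-- The vector of the values of the row functions at the rows of the matrix `z`. -/
def rowVals (g : Fin n → BoolFn (Fin m)) (z : Cube (Fin n × Fin m)) : Cube (Fin n) :=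
  fun i => g i fun j => z (i, j)

/-- The vector of the values of the column functions at the columns of the matrix `z`. -/
def colVals (f : Fin m → BoolFn (Fin n)) (z : Cube (Fin n × Fin m)) : Cube (Fin m) :=
  fun j => f j fun i => z (i, j)

/-- The transposed matrix. -/
def transposeMatrix (z : Cube (Fin n × Fin m)) : Cube (Fin m × Fin n) := fun p => z p.swap

lemma IsGeneralizedPolymorphism.transpose {f₀ : BoolFn (Fin n)} {f : Fin m → BoolFn (Fin n)}
    {g₀ : BoolFn (Fin m)} {g : Fin n → BoolFn (Fin m)}
    (h : IsGeneralizedPolymorphism f₀ f g₀ g) : IsGeneralizedPolymorphism g₀ g f₀ f :=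
  fun z => (h (transposeMatrix z)).symm

end Vals

/-! ### Symmetric description of the solution formulas -/

namespace SolutionData

variable {n m k : ℕ} (S : SolutionData n m k)

/-- The solution data for the transposed matrix, with the roles of the row functions and the
column functions interchanged. -/
def transpose : SolutionData m n k where
  Z l := transposeSet (S.Z l)
  nonempty l := (S.nonempty l).map
  row_disjoint l l' h := by
    rw [rows_transposeSet, rows_transposeSet]; exact S.col_disjoint l l' h
  col_disjoint l l' h := by
    rw [cols_transposeSet, cols_transposeSet]; exact S.row_disjoint l l' h
  not_isolated l h j i hji := by
    rw [card_transposeSet] at h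
    rw [rowsTwo_transposeSet, colsTwo_transposeSet]
    exact (S.not_isolated l h i j (mem_transposeSet.1 hji)).symm
  kind := S.kind
  kind_singleton l := by rw [card_transposeSet]; exact S.kind_singleton l
  h := S.h
  sgnF := S.sgnG
  sgnG := S.sgnF
  φ i u := S.γ i fun j => u ⟨j.1, by
    rw [blockUnion_transposeSet, colDepOne_transposeSet]; exact j.2⟩
  γ j u := S.φ j fun i => u ⟨i.1, by
    rw [blockUnion_transposeSet, rowDepOne_transposeSet]; exact i.2⟩
  B := S.D
  D := S.B
  κ j i := S.κ i j
  B_eq_zero i h := S.D_eq_zero i (by rwa [blockUnion_transposeSet, colsTwo_transposeSet] at h)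
  D_eq_zero j h := S.B_eq_zero j (by rwa [blockUnion_transposeSet, rowsTwo_transposeSet] at h)
  κ_eq_zero j i h := S.κ_eq_zero i j (by
    rw [blockUnion_transposeSet, rowsTwo_transposeSet, colsTwo_transposeSet,
      mem_transposeSet] at h
    tauto)
  xor_col l hl i hi := by
    rw [cols_transposeSet] at hi
    exact ⟨(S.xor_row l hl i hi).1, fun u => (S.xor_row l hl i hi).2 _⟩
  xor_row l hl j hj := by
    rw [rows_transposeSet] at hj
    exact ⟨(S.xor_col l hl j hj).1, fun u => (S.xor_col l hl j hj).2 _⟩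
  xor_shift l hl j i hji := S.xor_shift l hl i j (mem_transposeSet.1 hji)
  xor_sgnF l hl i hi u := by
    rw [colsOne_transposeSet] at hi
    exact S.xor_sgnG l hl i hi _
  xor_sgnG l hl j hj u := by
    rw [rowsOne_transposeSet] at hj
    exact S.xor_sgnF l hl j hj _
  andOr_col l hl i hi := by
    rw [colsTwo_transposeSet] at hi
    exact ⟨(S.andOr_row l hl i hi).1, fun u => (S.andOr_row l hl i hi).2 _⟩
  andOr_row l hl j hj := by
    rw [rowsTwo_transposeSet] at hj
    exact ⟨(S.andOr_col l hl j hj).1, fun u => (S.andOr_col l hl j hj).2 _⟩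
  andOr_shift l hl j i hji hj hi := S.andOr_shift l hl i j (mem_transposeSet.1 hji)
    (by rwa [colsTwo_transposeSet] at hi) (by rwa [rowsTwo_transposeSet] at hj)

lemma transpose_Z (l : Fin k) : S.transpose.Z l = transposeSet (S.Z l) := rfl

lemma transpose_Z₀ : S.transpose.Z₀ = transposeSet S.Z₀ := blockUnion_transposeSet S.Z

lemma transpose_xSgn (y : Cube (Fin m)) : S.transpose.xSgn y = S.ySgn y := by
  ext j
  rw [xSgn, ySgn, transpose_Z₀, rowsOne_transposeSet]
  rfl

variable {S} {l : Fin k} {i : Fin n} {j : Fin m}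

lemma mem_Z₀_of_mem (h : (i, j) ∈ S.Z l) : (i, j) ∈ S.Z₀ :=
  Finset.mem_biUnion.2 ⟨l, Finset.mem_univ _, h⟩

lemma mem_Z_of_mem_rows (hi : i ∈ rows (S.Z l)) (h : (i, j) ∈ S.Z₀) : (i, j) ∈ S.Z l := by
  obtain ⟨l', -, hl'⟩ := Finset.mem_biUnion.1 h
  by_cases hll : l = l'
  · rwa [hll]
  · exact absurd (mem_rows.2 ⟨j, hl'⟩) (Finset.disjoint_left.1 (S.row_disjoint l l' hll) hi)

lemma mem_Z_of_mem_cols (hj : j ∈ cols (S.Z l)) (h : (i, j) ∈ S.Z₀) : (i, j) ∈ S.Z l := by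
  rw [← mem_transposeSet, ← transpose_Z]
  refine mem_Z_of_mem_rows ?_ ?_
  · rwa [transpose_Z, rows_transposeSet]
  · rwa [transpose_Z₀, mem_transposeSet]

lemma rowEntries_block (hi : i ∈ rows (S.Z l)) : rowEntries S.Z₀ i = rowEntries (S.Z l) i := by
  ext j
  rw [mem_rowEntries, mem_rowEntries]
  exact ⟨mem_Z_of_mem_rows hi, mem_Z₀_of_mem⟩

lemma mem_rowsTwo_block (hi : i ∈ rows (S.Z l)) : i ∈ rowsTwo (S.Z l) ↔ i ∈ rowsTwo S.Z₀ := by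
  rw [mem_rowsTwo, mem_rowsTwo, rowEntries_block hi]

lemma mem_rowsOne_block (hi : i ∈ rows (S.Z l)) : i ∈ rowsOne (S.Z l) ↔ i ∈ rowsOne S.Z₀ := by
  rw [mem_rowsOne, mem_rowsOne, rowEntries_block hi]

lemma mem_colsTwo_block (hj : j ∈ cols (S.Z l)) : j ∈ colsTwo (S.Z l) ↔ j ∈ colsTwo S.Z₀ := by
  simpa only [transpose_Z, transpose_Z₀, rowsTwo_transposeSet] using
    mem_rowsTwo_block (S := S.transpose) (l := l) (i := j)
      (by rwa [transpose_Z, rows_transposeSet])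

lemma mem_colsOne_block (hj : j ∈ cols (S.Z l)) : j ∈ colsOne (S.Z l) ↔ j ∈ colsOne S.Z₀ := by
  simpa only [transpose_Z, transpose_Z₀, rowsOne_transposeSet] using
    mem_rowsOne_block (S := S.transpose) (l := l) (i := j)
      (by rwa [transpose_Z, rows_transposeSet])

/-- The double products over the rows and over the columns of a block, restricted to positions
that are alone neither in their row nor in their column, agree. -/
lemma prod_rowDepTwo_eq_prod_colDepTwo (t : Fin n → Fin m → ℝ) :
    ∏ i ∈ rowsTwo (S.Z l), ∏ j ∈ rowDepTwo S.Z₀ i, t i j =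
      ∏ j ∈ colsTwo (S.Z l), ∏ i ∈ colDepTwo S.Z₀ j, t i j := by
  refine Finset.prod_comm' fun i j => ?_
  rw [mem_rowDepTwo, mem_colDepTwo]
  constructor
  · rintro ⟨hi, hij, hj⟩
    have hr := rowsTwo_subset_rows hi
    have hc := mem_cols.2 ⟨i, mem_Z_of_mem_rows hr hij⟩
    exact ⟨⟨hij, (mem_rowsTwo_block hr).1 hi⟩, (mem_colsTwo_block hc).2 hj⟩
  · rintro ⟨⟨hij, hi⟩, hj⟩
    have hc := colsTwo_subset_cols hj
    have hr := mem_rows.2 ⟨j, mem_Z_of_mem_cols hc hij⟩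
    exact ⟨(mem_rowsTwo_block hr).2 hi, hij, (mem_colsTwo_block hc).1 hj⟩

variable (S)

/-- The formula that the solution data prescribe for the column function `u` of a column `j`
of the block `l`. -/
def ColForm (l : Fin k) (j : Fin m) (u : BoolFn (Fin n)) : Prop :=
  match S.kind l with
  | BlockKind.singleton => ∀ i, (i, j) ∈ S.Z l → ∀ x, u x = S.sgnF j * x i
  | BlockKind.xor => ∀ x, val (u x) = S.phiAt j x * ∏ i ∈ colDepTwo S.Z₀ j, val (x i)
  | BlockKind.andOr =>
    (j ∈ colsOne (S.Z l) → ∀ i, (i, j) ∈ S.Z l → ∀ x, u x = S.sgnF j * x i) ∧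
    (j ∈ colsTwo (S.Z l) → ∀ x, val (u x) =
      S.phiAt j x * (2 * S.B j) * (∏ i ∈ colDepTwo S.Z₀ j, (S.κ i j * val (x i) + 1) / 2)
        - S.B j)

/-- The formula that the solution data prescribe for the inner function `F` of `f₀` that belongs
to the block `l`. -/
def OuterForm (l : Fin k) (F : BoolFn (Fin n)) : Prop :=
  match S.kind l with
  | BlockKind.singleton => ∀ i j, (i, j) ∈ S.Z l → ∀ x, F x = S.sgnF j * x i
  | BlockKind.xor => ∀ x, val (F x) =
    (∏ i ∈ rowsTwo (S.Z l), val (x i)) * ∏ j ∈ colsTwo (S.Z l), S.phiAt j (S.xSgn x)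
  | BlockKind.andOr => ∀ x, val (F x) =
    2 * (∏ i ∈ rowsTwo (S.Z l), (S.D i * val (x i) + 1) / 2) *
      (∏ j ∈ colsTwo (S.Z l), S.phiAt j (S.xSgn x)) - 1

lemma blockForm_iff {f : Fin m → BoolFn (Fin n)} {g : Fin n → BoolFn (Fin m)}
    {F : BoolFn (Fin n)} {G : BoolFn (Fin m)} :
    S.BlockForm l f g F G ↔
      (∀ j ∈ cols (S.Z l), S.ColForm l j (f j)) ∧
      (∀ i ∈ rows (S.Z l), S.transpose.ColForm l i (g i)) ∧
      S.OuterForm l F ∧ S.transpose.OuterForm l G := by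
  have hk : S.transpose.kind = S.kind := rfl
  have hphi : ∀ i y, S.transpose.phiAt i y = S.gammaAt i y := fun _ _ => rfl
  have hB : S.transpose.B = S.D := rfl
  have hD : S.transpose.D = S.B := rfl
  have hκ : ∀ i j, S.transpose.κ j i = S.κ i j := fun _ _ => rfl
  have hs : S.transpose.sgnF = S.sgnG := rfl
  unfold BlockForm ColForm OuterForm SingletonForm XorForm AndOrForm
  simp only [hk, hphi, hB, hD, hκ, hs, transpose_Z, transpose_Z₀, mem_transposeSet,
    colDepTwo_transposeSet, colsOne_transposeSet, colsTwo_transposeSet, rowsTwo_transposeSet,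
    transpose_xSgn]
  rcases S.kind l with _ | _ | _
  · dsimp only
    constructor
    · intro h
      exact ⟨fun j _ i hij => (h i j hij).1, fun i _ j hij => (h i j hij).2.1,
        fun i j hij => (h i j hij).2.2.1, fun j i hij => (h i j hij).2.2.2⟩
    · rintro ⟨h1, h2, h3, h4⟩ i j hij
      exact ⟨h1 j (mem_cols.2 ⟨i, hij⟩) i hij, h2 i (mem_rows.2 ⟨j, hij⟩) j hij,
        h3 i j hij, h4 j i hij⟩
  · exact Iff.rfl
  · dsimp only
    constructor
    · rintro ⟨h1, h2, h3, h4, h5, h6⟩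
      exact ⟨fun j _ => ⟨fun hj i hij => h1 i j hij hj, h3 j⟩,
        fun i _ => ⟨fun hi j hij => h2 i j hij hi, h4 i⟩, h5, h6⟩
    · rintro ⟨h1, h2, h5, h6⟩
      exact ⟨fun i j hij hj => (h1 j (mem_cols.2 ⟨i, hij⟩)).1 hj i hij,
        fun i j hij hi => (h2 i (mem_rows.2 ⟨j, hij⟩)).1 hi j hij,
        fun j hj => (h1 j (colsTwo_subset_cols hj)).2 hj,
        fun i hi => (h2 i (rowsTwo_subset_rows hi)).2 hi, h5, h6⟩

end SolutionData

/-! ### The block identity -/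

namespace SolutionData

variable {n m k : ℕ} {S : SolutionData n m k} {l : Fin k} {i : Fin n} {j : Fin m}

/-- The column function of a one-element column is a dictator, whatever the kind of its block. -/
lemma ColForm.eq_dictator {u : BoolFn (Fin n)} (hu : S.ColForm l j u) (hij : (i, j) ∈ S.Z l)
    (hj : j ∈ colsOne S.Z₀) (x : Cube (Fin n)) : u x = S.sgnF j * x i := by
  have hc := mem_cols.2 ⟨i, hij⟩
  rw [← mem_colsOne_block hc] at hj
  unfold ColForm at hu
  rcases hk : S.kind l with _ | _ | _ <;> simp only [hk] at hu
  · exact hu i hij x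
  · have h1 : (S.Z l).card ≠ 1 := fun h => by
      rw [(S.kind_singleton l).2 h] at hk
      cases hk
    have h2 : i ∈ rowsTwo S.Z₀ := (mem_rowsTwo_block (mem_rows.2 ⟨j, hij⟩)).1
      ((S.not_isolated l h1 i j hij).resolve_right (notMem_colsTwo_of_colsOne hj))
    have h3 : colDepTwo S.Z₀ j = {i} := by
      have h4 := colEntries_of_colsOne (mem_Z₀_of_mem hij) ((mem_colsOne_block hc).1 hj)
      rw [colDepTwo, h4, Finset.singleton_inter_of_mem h2]
    apply val_injective
    rw [hu x, h3, Finset.prod_singleton, phiAt, S.xor_sgnF l hk j hj, val_mul]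
  · exact hu.1 hj i hij x

/-- The signs in `x^sgn` undo the signs of the dictators, so that the embedded functions see the
entries of the matrix. -/
lemma phiAt_xSgn_rowVals {g : Fin n → BoolFn (Fin m)}
    (hg : ∀ i ∈ rows (S.Z l), S.transpose.ColForm l i (g i)) (hj : j ∈ cols (S.Z l))
    (z : Cube (Fin n × Fin m)) :
    S.phiAt j (S.xSgn (rowVals g z)) = S.phiAt j fun i => z (i, j) := by
  refine congrArg (S.φ j) (funext fun i => ?_)
  obtain ⟨hij, hi⟩ := mem_colDepOne.1 i.2
  have hl := mem_Z_of_mem_cols hj hij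
  have h1 : g i.1 (fun j => z (i.1, j)) = S.sgnG i.1 * z (i.1, j) :=
    (hg i.1 (mem_rows.2 ⟨j, hl⟩)).eq_dictator (S := S.transpose) (mem_transposeSet.2 hl)
      (by rwa [transpose_Z₀, colsOne_transposeSet]) _
  have h2 : i.1 ∈ rowsOne S.Z₀ := hi
  simp only [xSgn, h2, if_true, rowVals, h1, ← mul_assoc, Int.units_mul_self, one_mul]

variable {f : Fin m → BoolFn (Fin n)} {g : Fin n → BoolFn (Fin m)}
  {F : BoolFn (Fin n)} {G : BoolFn (Fin m)}

lemma colForm_transpose_transpose (u : BoolFn (Fin n)) :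
    S.transpose.transpose.ColForm l j u ↔ S.ColForm l j u := by
  simp only [ColForm, transpose_Z, transpose_Z₀, mem_transposeSet, colDepTwo_transposeSet,
    rowDepTwo_transposeSet, colsOne_transposeSet, rowsOne_transposeSet, colsTwo_transposeSet,
    rowsTwo_transposeSet]
  rfl

lemma val_outer_rowVals_xor (hk : S.kind l = BlockKind.xor)
    (hg : ∀ i ∈ rows (S.Z l), S.transpose.ColForm l i (g i)) (hF : S.OuterForm l F)
    (z : Cube (Fin n × Fin m)) :
    val (F (rowVals g z)) =
      (∏ i ∈ rowsTwo (S.Z l), ∏ j ∈ rowDepTwo S.Z₀ i, val (z (i, j))) *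
      ((∏ i ∈ rowsTwo (S.Z l), S.gammaAt i fun j => z (i, j)) *
        ∏ j ∈ colsTwo (S.Z l), S.phiAt j fun i => z (i, j)) := by
  have h1 : ∏ j ∈ colsTwo (S.Z l), S.phiAt j (S.xSgn (rowVals g z)) =
      ∏ j ∈ colsTwo (S.Z l), S.phiAt j fun i => z (i, j) :=
    Finset.prod_congr rfl fun j hj => phiAt_xSgn_rowVals hg (colsTwo_subset_cols hj) z
  have h2 : ∏ i ∈ rowsTwo (S.Z l), val (rowVals g z i) =
      ∏ i ∈ rowsTwo (S.Z l), (S.gammaAt i fun j => z (i, j)) *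
        ∏ j ∈ rowDepTwo S.Z₀ i, val (z (i, j)) := by
    refine Finset.prod_congr rfl fun i hi => ?_
    have h3 := hg i (rowsTwo_subset_rows hi)
    have hk' : S.transpose.kind l = BlockKind.xor := hk
    simp only [ColForm, hk', transpose_Z₀, colDepTwo_transposeSet] at h3
    exact h3 _
  simp only [OuterForm, hk] at hF
  rw [hF, h1, h2, Finset.prod_mul_distrib]
  ring

lemma val_outer_rowVals_andOr (hk : S.kind l = BlockKind.andOr)
    (hg : ∀ i ∈ rows (S.Z l), S.transpose.ColForm l i (g i)) (hF : S.OuterForm l F)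
    (z : Cube (Fin n × Fin m)) :
    val (F (rowVals g z)) =
      2 * ((∏ i ∈ rowsTwo (S.Z l), ∏ j ∈ rowDepTwo S.Z₀ i, (S.κ i j * val (z (i, j)) + 1) / 2) *
      ((∏ i ∈ rowsTwo (S.Z l), S.gammaAt i fun j => z (i, j)) *
        ∏ j ∈ colsTwo (S.Z l), S.phiAt j fun i => z (i, j))) - 1 := by
  have h1 : ∏ j ∈ colsTwo (S.Z l), S.phiAt j (S.xSgn (rowVals g z)) =
      ∏ j ∈ colsTwo (S.Z l), S.phiAt j fun i => z (i, j) :=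
    Finset.prod_congr rfl fun j hj => phiAt_xSgn_rowVals hg (colsTwo_subset_cols hj) z
  have h2 : ∏ i ∈ rowsTwo (S.Z l), (S.D i * val (rowVals g z i) + 1) / 2 =
      ∏ i ∈ rowsTwo (S.Z l), (S.gammaAt i fun j => z (i, j)) *
        ∏ j ∈ rowDepTwo S.Z₀ i, (S.κ i j * val (z (i, j)) + 1) / 2 := by
    refine Finset.prod_congr rfl fun i hi => ?_
    have h3 := hg i (rowsTwo_subset_rows hi)
    have hk' : S.transpose.kind l = BlockKind.andOr := hk
    simp only [ColForm, hk', transpose_Z₀, transpose_Z, colDepTwo_transposeSet,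
      colsTwo_transposeSet] at h3
    have h4 : val (rowVals g z i) = _ := h3.2 hi fun j => z (i, j)
    rw [h4]
    have h5 : S.transpose.B i = S.D i := rfl
    have h6 : S.transpose.phiAt i (fun j => z (i, j)) = S.gammaAt i fun j => z (i, j) := rfl
    rw [h5, h6]
    simp only [show ∀ j, S.transpose.κ j i = S.κ i j from fun _ => rfl]
    rcases ((S.andOr_row l hk i hi).1) with h | h <;> rw [h] <;> ring
  simp only [OuterForm, hk] at hF
  rw [hF, h1, h2, Finset.prod_mul_distrib]
  ring

/-- The identity of the generalized polymorphism within one block. -/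
lemma outer_rowVals_eq_outer_colVals (hf : ∀ j ∈ cols (S.Z l), S.ColForm l j (f j))
    (hg : ∀ i ∈ rows (S.Z l), S.transpose.ColForm l i (g i)) (hF : S.OuterForm l F)
    (hG : S.transpose.OuterForm l G) (z : Cube (Fin n × Fin m)) :
    F (rowVals g z) = G (colVals f z) := by
  have hf' : ∀ j ∈ rows (S.transpose.Z l), S.transpose.transpose.ColForm l j (f j) := fun j hj =>
    (colForm_transpose_transpose (f j)).2 (hf j (by rwa [transpose_Z, rows_transposeSet] at hj))
  rcases hk : S.kind l with _ | _ | _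
  · obtain ⟨⟨i, j⟩, hp⟩ := Finset.card_eq_one.1 ((S.kind_singleton l).1 hk)
    have hij : (i, j) ∈ S.Z l := by simp [hp]
    have hk' : S.transpose.kind l = BlockKind.singleton := hk
    have h1 := hf j (mem_cols.2 ⟨i, hij⟩)
    have h2 := hg i (mem_rows.2 ⟨j, hij⟩)
    simp only [ColForm, OuterForm, hk, hk'] at h1 h2 hF hG
    rw [hF i j hij, hG j i (mem_transposeSet.2 hij), rowVals, colVals, h1 i hij,
      h2 j (mem_transposeSet.2 hij), ← mul_assoc, ← mul_assoc]
    exact congrArg (· * z (i, j)) (mul_comm (S.sgnF j) (S.sgnG i))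
  · have h1 := val_outer_rowVals_xor hk hg hF z
    have h2 := val_outer_rowVals_xor (S := S.transpose) hk hf' hG (transposeMatrix z)
    simp only [transpose_Z, transpose_Z₀, rowsTwo_transposeSet, colsTwo_transposeSet,
      rowDepTwo_transposeSet] at h2
    apply val_injective
    rw [h1, prod_rowDepTwo_eq_prod_colDepTwo fun i j => val (z (i, j)),
      mul_comm (∏ i ∈ rowsTwo (S.Z l), S.gammaAt i fun j => z (i, j))]
    exact h2.symm
  · have h1 := val_outer_rowVals_andOr hk hg hF z
    have h2 := val_outer_rowVals_andOr (S := S.transpose) hk hf' hG (transposeMatrix z)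
    simp only [transpose_Z, transpose_Z₀, rowsTwo_transposeSet, colsTwo_transposeSet,
      rowDepTwo_transposeSet] at h2
    apply val_injective
    rw [h1, prod_rowDepTwo_eq_prod_colDepTwo fun i j => (S.κ i j * val (z (i, j)) + 1) / 2,
      mul_comm (∏ i ∈ rowsTwo (S.Z l), S.gammaAt i fun j => z (i, j))]
    exact h2.symm

theorem HasForm.isGeneralizedPolymorphism {f₀ : BoolFn (Fin n)} {g₀ : BoolFn (Fin m)}
    (h : S.HasForm f₀ f g₀ g) : IsGeneralizedPolymorphism f₀ f g₀ g := by
  obtain ⟨F, G, hf₀, hg₀, hb⟩ := h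
  intro z
  change f₀ (rowVals g z) = g₀ (colVals f z)
  rw [hf₀, hg₀]
  refine congrArg S.h (funext fun l => ?_)
  obtain ⟨h1, h2, h3, h4⟩ := (S.blockForm_iff).1 (hb l)
  exact outer_rowVals_eq_outer_colVals h1 h2 h3 h4 z

/-! ### Existence of functions with given solution data -/

lemma prod_eq_one_or_neg_one {α : Type*} {s : Finset α} {a : α → ℝ}
    (h : ∀ i ∈ s, a i = 1 ∨ a i = -1) : ∏ i ∈ s, a i = 1 ∨ ∏ i ∈ s, a i = -1 := by
  refine Finset.prod_induction a (fun r => r = 1 ∨ r = -1) ?_ (Or.inl rfl) h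
  rintro a b (rfl | rfl) (rfl | rfl) <;> norm_num

lemma prod_eq_zero_or_one {α : Type*} {s : Finset α} {a : α → ℝ}
    (h : ∀ i ∈ s, a i = 0 ∨ a i = 1) : ∏ i ∈ s, a i = 0 ∨ ∏ i ∈ s, a i = 1 := by
  refine Finset.prod_induction a (fun r => r = 0 ∨ r = 1) ?_ (Or.inr rfl) h
  rintro a b (rfl | rfl) (rfl | rfl) <;> norm_num

lemma mul_val_add_one_div_two {r : ℝ} (hr : r = 1 ∨ r = -1) (s : ℤˣ) :
    (r * val s + 1) / 2 = 0 ∨ (r * val s + 1) / 2 = 1 := by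
  rcases hr with rfl | rfl <;> rcases val_eq_one_or s with h | h <;> rw [h] <;> norm_num

lemma exists_boolFn {ι : Type} {r : Cube ι → ℝ} (h : ∀ x, r x = 1 ∨ r x = -1) :
    ∃ u : BoolFn ι, ∀ x, val (u x) = r x :=
  ⟨fun x => (exists_val_eq (h x)).choose, fun x => (exists_val_eq (h x)).choose_spec⟩

variable (S)

lemma exists_outerForm (l : Fin k) : ∃ F, S.OuterForm l F := by
  unfold OuterForm
  rcases hk : S.kind l with _ | _ | _ <;> dsimp only
  · obtain ⟨⟨i, j⟩, hp⟩ := Finset.card_eq_one.1 ((S.kind_singleton l).1 hk)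
    refine ⟨fun x => S.sgnF j * x i, fun i' j' h x => ?_⟩
    rw [hp, Finset.mem_singleton, Prod.mk.injEq] at h
    rw [h.1, h.2]
  · refine exists_boolFn fun x => ?_
    have h1 := prod_eq_one_or_neg_one (s := rowsTwo (S.Z l)) fun i _ => val_eq_one_or (x i)
    have h2 := prod_eq_one_or_neg_one (s := colsTwo (S.Z l)) fun j hj =>
      (S.xor_col l hk j (colsTwo_subset_cols hj)).2 fun i => S.xSgn x i
    change _ * (∏ j ∈ colsTwo (S.Z l), S.φ j fun i => S.xSgn x i) = 1 ∨
      _ * (∏ j ∈ colsTwo (S.Z l), S.φ j fun i => S.xSgn x i) = -1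
    rcases h1 with h1 | h1 <;> rcases h2 with h2 | h2 <;> rw [h1, h2] <;> norm_num
  · refine exists_boolFn fun x => ?_
    have h1 := prod_eq_zero_or_one (s := rowsTwo (S.Z l)) fun i hi =>
      mul_val_add_one_div_two (S.andOr_row l hk i hi).1 (x i)
    have h2 := prod_eq_zero_or_one (s := colsTwo (S.Z l)) fun j hj =>
      (S.andOr_col l hk j hj).2 fun i => S.xSgn x i
    change 2 * _ * (∏ j ∈ colsTwo (S.Z l), S.φ j fun i => S.xSgn x i) - 1 = 1 ∨
      2 * _ * (∏ j ∈ colsTwo (S.Z l), S.φ j fun i => S.xSgn x i) - 1 = -1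
    rcases h1 with h1 | h1 <;> rcases h2 with h2 | h2 <;> rw [h1, h2] <;> norm_num

lemma exists_colForm {l : Fin k} {j : Fin m} (hc : j ∈ cols (S.Z l)) : ∃ u, S.ColForm l j u := by
  unfold ColForm
  rcases hk : S.kind l with _ | _ | _ <;> dsimp only
  · obtain ⟨⟨i, j'⟩, hp⟩ := Finset.card_eq_one.1 ((S.kind_singleton l).1 hk)
    refine ⟨fun x => S.sgnF j * x i, fun i' h x => ?_⟩
    rw [hp, Finset.mem_singleton, Prod.mk.injEq] at h
    rw [h.1]
  · refine exists_boolFn fun x => ?_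
    have h1 := prod_eq_one_or_neg_one (s := colDepTwo S.Z₀ j) fun i _ => val_eq_one_or (x i)
    have h2 := (S.xor_col l hk j hc).2 fun i => x i
    change (S.φ j fun i => x i) * _ = 1 ∨ (S.φ j fun i => x i) * _ = -1
    rcases h1 with h1 | h1 <;> rcases h2 with h2 | h2 <;> rw [h1, h2] <;> norm_num
  · obtain ⟨i, hi⟩ := mem_cols.1 hc
    rcases colsOne_or_colsTwo hi with hj | hj
    · refine ⟨fun x => S.sgnF j * x i, fun _ i' hi' x => ?_,
        fun h => absurd h (notMem_colsTwo_of_colsOne hj)⟩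
      have h1 := mem_colEntries.2 hi'
      rw [colEntries_of_colsOne hi hj, Finset.mem_singleton] at h1
      rw [h1]
    · have h0 : ∀ x : Cube (Fin n), S.phiAt j x * (2 * S.B j) *
          (∏ i ∈ colDepTwo S.Z₀ j, (S.κ i j * val (x i) + 1) / 2) - S.B j = 1 ∨
          S.phiAt j x * (2 * S.B j) *
          (∏ i ∈ colDepTwo S.Z₀ j, (S.κ i j * val (x i) + 1) / 2) - S.B j = -1 := by
        intro x
        have h1 : ∏ i ∈ colDepTwo S.Z₀ j, (S.κ i j * val (x i) + 1) / 2 = 0 ∨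
            ∏ i ∈ colDepTwo S.Z₀ j, (S.κ i j * val (x i) + 1) / 2 = 1 := by
          refine prod_eq_zero_or_one fun i hi => mul_val_add_one_div_two ?_ (x i)
          obtain ⟨hij, hi⟩ := mem_colDepTwo.1 hi
          have hl := mem_Z_of_mem_cols hc hij
          exact S.andOr_shift l hk i j hl ((mem_rowsTwo_block (mem_rows.2 ⟨j, hl⟩)).2 hi) hj
        obtain ⟨h2, h3⟩ := S.andOr_col l hk j hj
        have h3 : S.phiAt j x = 0 ∨ S.phiAt j x = 1 := h3 _
        rcases h1 with h1 | h1 <;> rcases h2 with h2 | h2 <;> rcases h3 with h3 | h3 <;>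
          rw [h1, h2, h3] <;> norm_num
      obtain ⟨u, hu⟩ := exists_boolFn h0
      exact ⟨u, fun h => absurd hj (notMem_colsTwo_of_colsOne h), fun _ => hu⟩

lemma exists_forall_colForm :
    ∃ f : Fin m → BoolFn (Fin n), ∀ l, ∀ j ∈ cols (S.Z l), S.ColForm l j (f j) := by
  have h : ∀ j, ∃ u : BoolFn (Fin n), ∀ l, j ∈ cols (S.Z l) → S.ColForm l j u := by
    intro j
    by_cases hj : ∃ l, j ∈ cols (S.Z l)
    · obtain ⟨l, hl⟩ := hj
      obtain ⟨u, hu⟩ := S.exists_colForm hl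
      refine ⟨u, fun l' hl' => ?_⟩
      by_cases hll : l = l'
      · rwa [← hll]
      · exact absurd hl' (Finset.disjoint_left.1 (S.col_disjoint l l' hll) hl)
    · exact ⟨1, fun l hl => absurd ⟨l, hl⟩ hj⟩
  choose f hf using h
  exact ⟨f, fun l j hj => hf j l hj⟩

theorem exists_hasForm : ∃ f₀ f g₀ g, S.HasForm f₀ f g₀ g := by
  obtain ⟨f, hf⟩ := S.exists_forall_colForm
  obtain ⟨g, hg⟩ := S.transpose.exists_forall_colForm
  choose F hF using S.exists_outerForm
  choose G hG using S.transpose.exists_outerForm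
  refine ⟨fun x => S.h fun l => F l x, f, fun y => S.h fun l => G l y, g, F, G, fun _ => rfl,
    fun _ => rfl, fun l => S.blockForm_iff.2 ⟨hf l, fun i hi => hg l i ?_, hF l, hG l⟩⟩
  rwa [transpose_Z, cols_transposeSet]

end SolutionData

/-! ### Sensitivity of a composition -/

section Composition

variable {n m : ℕ} {f₀ : BoolFn (Fin n)} {f : Fin m → BoolFn (Fin n)} {g₀ : BoolFn (Fin m)}
  {g : Fin n → BoolFn (Fin m)} {i i' : Fin n} {j j' : Fin m}

lemma rowVals_flip_of_ne {i' : Fin n} (h : i' ≠ i) (z : Cube (Fin n × Fin m)) :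
    rowVals g (flip (i, j) z) i' = rowVals g z i' :=
  congrArg (g i') (funext fun j' => flip_ne (by simp [h]) z)

lemma row_flip (z : Cube (Fin n × Fin m)) :
    (fun j' => flip (i, j) z (i, j')) = flip j fun j' => z (i, j') := by
  ext j'
  by_cases h : j' = j
  · subst h; rw [flip_same, flip_same]
  · rw [flip_ne (by simp [h]), flip_ne h]

lemma rowVals_flip (z : Cube (Fin n × Fin m)) :
    rowVals g (flip (i, j) z) =
      Function.update (rowVals g z) i (g i (flip j fun j' => z (i, j'))) := by
  ext i'
  by_cases h : i' = i
  · subst h; rw [Function.update_self, rowVals, row_flip]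
  · rw [Function.update_of_ne h, rowVals_flip_of_ne h]

lemma rowVals_flip_of_sensAt {z : Cube (Fin n × Fin m)} (h : SensAt (g i) j fun j' => z (i, j')) :
    rowVals g (flip (i, j) z) = flip i (rowVals g z) := by
  rw [rowVals_flip, h.flip_eq]; rfl

lemma rowVals_flip_of_not_sensAt {z : Cube (Fin n × Fin m)}
    (h : ¬ SensAt (g i) j fun j' => z (i, j')) :
    rowVals g (flip (i, j) z) = rowVals g z := by
  rw [rowVals_flip, not_sensAt.1 h]
  exact Function.update_eq_self i (rowVals g z)

lemma transposeMatrix_flip (z : Cube (Fin n × Fin m)) :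
    transposeMatrix (flip (i, j) z) = flip (j, i) (transposeMatrix z) := by
  ext ⟨j', i'⟩
  by_cases h : (i', j') = (i, j)
  · obtain ⟨rfl, rfl⟩ := Prod.mk.inj h
    rw [flip_same, transposeMatrix, Prod.swap_prod_mk, flip_same]; rfl
  · rw [transposeMatrix, Prod.swap_prod_mk, flip_ne h, flip_ne (by simpa [and_comm] using h)]; rfl

lemma colVals_flip (z : Cube (Fin n × Fin m)) :
    colVals f (flip (i, j) z) =
      Function.update (colVals f z) j (f j (flip i fun i' => z (i', j))) := by
  have h : rowVals f (flip (j, i) (transposeMatrix z)) = _ := rowVals_flip _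
  rw [← transposeMatrix_flip] at h
  exact h

lemma colVals_flip_of_sensAt {z : Cube (Fin n × Fin m)} (h : SensAt (f j) i fun i' => z (i', j)) :
    colVals f (flip (i, j) z) = flip j (colVals f z) := by
  rw [colVals_flip, h.flip_eq]; rfl

lemma colVals_flip_of_not_sensAt {z : Cube (Fin n × Fin m)}
    (h : ¬ SensAt (f j) i fun i' => z (i', j)) :
    colVals f (flip (i, j) z) = colVals f z := by
  rw [colVals_flip, not_sensAt.1 h]
  exact Function.update_eq_self j (colVals f z)

lemma sensAt_rowComp {z : Cube (Fin n × Fin m)} :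
    SensAt (rowComp f₀ g) (i, j) z ↔
      SensAt (g i) j (fun j' => z (i, j')) ∧ SensAt f₀ i (rowVals g z) := by
  by_cases h : SensAt (g i) j fun j' => z (i, j')
  · have h1 : rowComp f₀ g (flip (i, j) z) = f₀ (flip i (rowVals g z)) :=
      congrArg f₀ (rowVals_flip_of_sensAt h)
    simp only [h, true_and]
    rw [SensAt, h1]
    rfl
  · have h1 : rowComp f₀ g (flip (i, j) z) = f₀ (rowVals g z) :=
      congrArg f₀ (rowVals_flip_of_not_sensAt h)
    simp only [h, false_and, iff_false, not_sensAt]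
    exact h1

lemma IsGeneralizedPolymorphism.rowVals_eq_colVals (h : IsGeneralizedPolymorphism f₀ f g₀ g)
    (z : Cube (Fin n × Fin m)) : f₀ (rowVals g z) = g₀ (colVals f z) := h z

/-- Sensitivity of the common composition at `(i, j)` factors in two ways: into a condition on the
row `i` and one on the remaining rows, and into a condition on the column `j` and one on the
remaining columns. -/
lemma IsGeneralizedPolymorphism.sensAt_iff (h : IsGeneralizedPolymorphism f₀ f g₀ g)
    (z : Cube (Fin n × Fin m)) :
    SensAt (g i) j (fun j' => z (i, j')) ∧ SensAt f₀ i (rowVals g z) ↔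
      SensAt (f j) i (fun i' => z (i', j)) ∧ SensAt g₀ j (colVals f z) := by
  have h1 : SensAt (rowComp f₀ g) (i, j) z ↔
      SensAt (rowComp g₀ f) (j, i) (transposeMatrix z) := by
    rw [SensAt, SensAt, h, h z, ← transposeMatrix_flip]
    rfl
  rw [← sensAt_rowComp, h1, sensAt_rowComp]
  rfl

lemma rowVals_surjective (hg : ∀ i, NonConstant (g i)) (u : Cube (Fin n)) :
    ∃ z, rowVals g z = u := by
  choose y hy using fun i => (hg i).exists_eq (u i)
  exact ⟨fun p => y p.1 p.2, funext hy⟩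

lemma exists_sensAt_rowVals (hg : ∀ i, NonConstant (g i)) (hi : i ∈ dep f₀) (a : Cube (Fin m)) :
    ∃ z, (∀ j, z (i, j) = a j) ∧ SensAt f₀ i (rowVals g z) := by
  obtain ⟨u, hu⟩ := mem_dep.1 hi
  obtain ⟨z, rfl⟩ := rowVals_surjective hg u
  refine ⟨fun p => if p.1 = i then a p.2 else z p, by simp, (sensAt_congr fun k hk => ?_).1 hu⟩
  simp [rowVals, hk]

/-- Suppose that flipping the `i'`-th entry of the column `x` destroys the sensitivity of `f j`
at `i`. Then it also destroys the sensitivity of the common composition at `(i, j)`, which in terms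
of rows depends on the row `i'` only through `g i'`; so it must force the value of `g i'`. -/
theorem IsGeneralizedPolymorphism.exists_canalizes (h : IsGeneralizedPolymorphism f₀ f g₀ g)
    (hg : ∀ i, NonConstant (g i)) (hi : i ∈ dep f₀) (hij : j ∈ dep (g i)) (hne : i' ≠ i)
    {x : Cube (Fin n)} (hx : SensAt (f j) i x) (hx' : ¬ SensAt (f j) i (flip i' x)) :
    ∃ c, Canalizes (g i') j (x i') c := by
  obtain ⟨a, ha⟩ := mem_dep.1 hij
  obtain ⟨z₀, hz₀, hs₀⟩ := exists_sensAt_rowVals hg hi a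
  obtain rfl : (fun j' => z₀ (i, j')) = a := funext hz₀
  have hq₀ := ((h.sensAt_iff z₀).1 ⟨ha, hs₀⟩).2
  -- the `j`-th column of `z₀` is replaced by `x`
  let z₁ : Cube (Fin n × Fin m) := fun p => if p.2 = j then x p.1 else z₀ p
  have hq₁ : SensAt g₀ j (colVals f z₁) :=
    (sensAt_congr fun k hk => by simp [colVals, z₁, hk]).1 hq₀
  have hx₁ : SensAt (f j) i fun k => z₁ (k, j) := by simpa [z₁] using hx
  obtain ⟨hg₁, hs₁⟩ := (h.sensAt_iff z₁).2 ⟨hx₁, hq₁⟩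
  refine ⟨g i' fun j' => z₁ (i', j'), fun y hy => ?_⟩
  by_contra hc
  have hc : g i' y = g i' fun j' => z₁ (i', j') := by
    by_contra h'
    exact hc (Int.units_ne_iff_eq_neg.1 h')
  -- the row `i'` of `z₁` is replaced by `y`, which does not affect the values of the row functions
  let z₂ : Cube (Fin n × Fin m) := fun p => if p.1 = i' then y p.2 else z₁ p
  have hr : rowVals g z₂ = rowVals g z₁ := by
    ext k
    by_cases hk : k = i'
    · subst hk; simp [rowVals, z₂, hc]
    · simp [rowVals, z₂, hk]
  have hcol : (fun k => z₂ (k, j)) = flip i' x := by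
    ext k
    by_cases hk : k = i'
    · subst hk; simp [z₂, flip_same, hy]
    · simp [z₂, z₁, hk, flip_ne hk]
  have hg₂ : SensAt (g i) j fun j' => z₂ (i, j') := by simpa [z₂, hne.symm] using hg₁
  refine hx' (hcol ▸ ((h.sensAt_iff z₂).1 ⟨hg₂, ?_⟩).1)
  rwa [hr]

end Composition

/-! ### The dichotomy between odd and canalizing coordinates -/

/-- A generalized polymorphism whose outer functions depend on all their inputs and whose inner
functions are not constant. -/
structure IsReduced {n m : ℕ} (f₀ : BoolFn (Fin n)) (f : Fin m → BoolFn (Fin n))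
    (g₀ : BoolFn (Fin m)) (g : Fin n → BoolFn (Fin m)) : Prop where
  gp : IsGeneralizedPolymorphism f₀ f g₀ g
  dep_f₀ : dep f₀ = Finset.univ
  dep_g₀ : dep g₀ = Finset.univ
  f_nonConstant : ∀ j, NonConstant (f j)
  g_nonConstant : ∀ i, NonConstant (g i)

/-- Row `i` contains at least two relevant positions, and `i` is a canalizing coordinate of every
column function that depends on it. With `f` and `g` interchanged, this is the corresponding notion
for columns. -/
def CanalizingRow {n m : ℕ} (f : Fin m → BoolFn (Fin n)) (g : Fin n → BoolFn (Fin m))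
    (i : Fin n) : Prop :=
  2 ≤ (dep (g i)).card ∧ ∀ j ∈ dep (g i), ∃ κ c, Canalizes (f j) i κ c

namespace IsReduced

variable {n m : ℕ} {f₀ : BoolFn (Fin n)} {f : Fin m → BoolFn (Fin n)} {g₀ : BoolFn (Fin m)}
  {g : Fin n → BoolFn (Fin m)} {i i' : Fin n} {j j' : Fin m}

lemma transpose (h : IsReduced f₀ f g₀ g) : IsReduced g₀ g f₀ f :=
  ⟨h.gp.transpose, h.dep_g₀, h.dep_f₀, h.g_nonConstant, h.f_nonConstant⟩

lemma mem_dep_f₀ (h : IsReduced f₀ f g₀ g) (i : Fin n) : i ∈ dep f₀ := by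
  rw [h.dep_f₀]; exact Finset.mem_univ i

lemma mem_dep_rowComp_iff (h : IsReduced f₀ f g₀ g) :
    (i, j) ∈ dep (rowComp f₀ g) ↔ j ∈ dep (g i) := by
  constructor
  · intro hp
    obtain ⟨z, hz⟩ := mem_dep.1 hp
    exact mem_dep.2 ⟨_, (sensAt_rowComp.1 hz).1⟩
  · intro hj
    obtain ⟨a, ha⟩ := mem_dep.1 hj
    obtain ⟨z, hz, hs⟩ := exists_sensAt_rowVals h.g_nonConstant (h.mem_dep_f₀ i) a
    obtain rfl : (fun j' => z (i, j')) = a := funext hz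
    exact mem_dep.2 ⟨z, sensAt_rowComp.2 ⟨ha, hs⟩⟩

lemma mem_dep_f_of_mem_dep_g (h : IsReduced f₀ f g₀ g) (hj : j ∈ dep (g i)) : i ∈ dep (f j) := by
  obtain ⟨z, hz⟩ := mem_dep.1 (h.mem_dep_rowComp_iff.2 hj)
  exact mem_dep.2 ⟨_, ((h.gp.sensAt_iff z).1 (sensAt_rowComp.1 hz)).1⟩

lemma mem_dep_g_iff_mem_dep_f (h : IsReduced f₀ f g₀ g) : j ∈ dep (g i) ↔ i ∈ dep (f j) :=
  ⟨h.mem_dep_f_of_mem_dep_g, h.transpose.mem_dep_f_of_mem_dep_g⟩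

/-- A canalizing coordinate `i` of a column function `f j` makes `j` a canalizing coordinate of
all row functions that meet the column `j`, with the same canalizing value for `g i`. -/
lemma canalizes_of_canalizes (h : IsReduced f₀ f g₀ g) {κ c : ℤˣ} (hc : Canalizes (f j) i κ c)
    (hi : i ∈ dep (f j)) (hi' : i' ∈ dep (f j)) (hne : i ≠ i') :
    (∃ c, Canalizes (g i) j κ c) ∧ ∃ κ c, Canalizes (g i') j κ c := by
  obtain ⟨x, rfl, hx, hx'⟩ := hc.exists_sensAt hne hi'
  obtain ⟨y, hy, hy'⟩ := exists_sensAt_flip_symm hx hx'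
  exact ⟨h.gp.exists_canalizes h.g_nonConstant (h.mem_dep_f₀ i') (h.mem_dep_g_iff_mem_dep_f.2 hi')
    hne hx hx', _, h.gp.exists_canalizes h.g_nonConstant (h.mem_dep_f₀ i)
    (h.mem_dep_g_iff_mem_dep_f.2 hi) hne.symm hy hy'⟩

/-- The canalizing property passes from a row to the columns that meet it. -/
lemma canalizingRow_transpose (h : IsReduced f₀ f g₀ g) (hi : CanalizingRow f g i)
    (hij : j ∈ dep (g i)) (hj : 2 ≤ (dep (f j)).card) : CanalizingRow g f j := by
  obtain ⟨κ, c, hc⟩ := hi.2 j hij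
  have hi' := h.mem_dep_g_iff_mem_dep_f.1 hij
  refine ⟨hj, fun k hk => ?_⟩
  by_cases hik : i = k
  · subst hik
    obtain ⟨b, hb, hne⟩ := Finset.exists_mem_ne hj i
    exact ⟨κ, (h.canalizes_of_canalizes hc hi' hb hne.symm).1⟩
  · exact (h.canalizes_of_canalizes hc hi' hk hik).2

/-- In a canalizing row, the row function and the column function that meet in a position have a
common canalizing value. -/
lemma exists_common_canalizes (h : IsReduced f₀ f g₀ g) (hi : CanalizingRow f g i)
    (hij : j ∈ dep (g i)) (hj : 2 ≤ (dep (f j)).card) :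
    ∃ κ, (∃ c, Canalizes (f j) i κ c) ∧ ∃ c, Canalizes (g i) j κ c := by
  obtain ⟨κ, c, hc⟩ := hi.2 j hij
  obtain ⟨b, hb, hne⟩ := Finset.exists_mem_ne hj i
  exact ⟨κ, ⟨c, hc⟩, (h.canalizes_of_canalizes hc (h.mem_dep_g_iff_mem_dep_f.1 hij) hb hne.symm).1⟩

/-- The column functions are odd in the rows that are not canalizing. -/
lemma oddAt_of_not_canalizingRow (h : IsReduced f₀ f g₀ g) (hcard : 2 ≤ (dep (g i)).card)
    (hi : ¬ CanalizingRow f g i) (hij : j ∈ dep (g i)) : OddAt (f j) i := by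
  refine oddAt_of_sensAt_flip (h.mem_dep_g_iff_mem_dep_f.1 hij) fun k hk x hx => ?_
  by_contra hx'
  obtain ⟨y, hy, hy'⟩ := exists_sensAt_flip_symm hx hx'
  have hkj : j ∈ dep (g k) := h.mem_dep_g_iff_mem_dep_f.2 (mem_dep.2 ⟨y, hy⟩)
  obtain ⟨c, hc⟩ :=
    h.gp.exists_canalizes h.g_nonConstant (h.mem_dep_f₀ k) hkj hk.symm hy hy'
  refine hi ⟨hcard, fun j' hj' => ?_⟩
  by_cases hjj : j = j'
  · subst hjj
    obtain ⟨b, hb, hne⟩ := Finset.exists_mem_ne hcard j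
    exact ⟨_, (h.transpose.canalizes_of_canalizes hc hij hb hne.symm).1⟩
  · exact (h.transpose.canalizes_of_canalizes hc hij hj' hjj).2

end IsReduced

namespace SolutionData

variable {n m k : ℕ} {S : SolutionData n m k} {l : Fin k} {i : Fin n} {j : Fin m}

/-! ### Odd and canalizing coordinates of the solution formulas -/

lemma phiAt_congr {x y : Cube (Fin n)} (h : ∀ i, (i, j) ∈ S.Z₀ → i ∈ rowsOne S.Z₀ → x i = y i) :
    S.phiAt j x = S.phiAt j y :=
  congrArg (S.φ j) (funext fun i => h i (mem_colDepOne.1 i.2).1 (mem_colDepOne.1 i.2).2)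

lemma phiAt_flip (hi : i ∈ rowsTwo S.Z₀) (x : Cube (Fin n)) :
    S.phiAt j (flip i x) = S.phiAt j x :=
  phiAt_congr fun k _ hk => flip_ne
    (fun e : k = i => notMem_rowsTwo_of_rowsOne hk (e ▸ hi)) x

lemma ColForm.oddAt {u : BoolFn (Fin n)} (hu : S.ColForm l j u) (hk : S.kind l = BlockKind.xor)
    (hij : (i, j) ∈ S.Z₀) (hi : i ∈ rowsTwo S.Z₀) : OddAt u i := by
  intro x
  simp only [ColForm, hk] at hu
  apply val_injective
  rw [val_neg, hu, hu, phiAt_flip hi, prod_val_flip (mem_colDepTwo.2 ⟨hij, hi⟩), mul_neg]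

lemma OuterForm.oddAt {F : BoolFn (Fin n)} (hF : S.OuterForm l F)
    (hk : S.kind l = BlockKind.xor) (hi : i ∈ rowsTwo (S.Z l)) : OddAt F i := by
  intro x
  simp only [OuterForm, hk] at hF
  have hi' := (mem_rowsTwo_block (rowsTwo_subset_rows hi)).1 hi
  have h1 : S.xSgn (flip i x) = flip i (S.xSgn x) := by
    ext a
    by_cases ha : a = i
    · subst ha
      have : a ∉ rowsOne S.Z₀ := fun h => notMem_rowsTwo_of_rowsOne h hi'
      simp [xSgn, this, flip_same]
    · simp [xSgn, flip_ne ha]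
  apply val_injective
  rw [val_neg, hF, hF, h1, prod_val_flip hi]
  simp only [phiAt_flip hi', neg_mul]

lemma kappa_eq_one_or (hk : S.kind l = BlockKind.andOr) (hij : (i, j) ∈ S.Z₀)
    (hj : j ∈ colsTwo (S.Z l)) (hi : i ∈ rowsTwo S.Z₀) : S.κ i j = 1 ∨ S.κ i j = -1 := by
  have hl := mem_Z_of_mem_cols (colsTwo_subset_cols hj) hij
  exact S.andOr_shift l hk i j hl ((mem_rowsTwo_block (mem_rows.2 ⟨j, hl⟩)).2 hi) hj

lemma ColForm.canalizes {u : BoolFn (Fin n)} (hu : S.ColForm l j u)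
    (hk : S.kind l = BlockKind.andOr) (hij : (i, j) ∈ S.Z₀) (hj : j ∈ colsTwo (S.Z l))
    (hi : i ∈ rowsTwo S.Z₀) : Canalizes u i (toSign (S.κ i j)) (toSign (S.B j)) := by
  intro x hx
  simp only [ColForm, hk] at hu
  apply val_injective
  rw [hu.2 hj, Finset.prod_eq_zero (mem_colDepTwo.2 ⟨hij, hi⟩), val_neg,
    val_toSign (S.andOr_col l hk j hj).1, mul_zero, zero_sub]
  rw [hx, mul_neg_toSign (kappa_eq_one_or hk hij hj hi)]

lemma ColForm.phiAt_eq_one {u : BoolFn (Fin n)} (hu : S.ColForm l j u)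
    (hk : S.kind l = BlockKind.andOr) (hj : j ∈ colsTwo (S.Z l)) {x : Cube (Fin n)}
    (hx : u x = toSign (S.B j)) : S.phiAt j x = 1 := by
  obtain ⟨hB, hφ⟩ := S.andOr_col l hk j hj
  refine (hφ _).resolve_left fun h0 => ?_
  have h0 : S.phiAt j x = 0 := h0
  simp only [ColForm, hk] at hu
  have h1 := hu.2 hj x
  rw [hx, val_toSign hB, h0] at h1
  rcases hB with h | h <;> rw [h] at h1 <;> norm_num at h1

lemma OuterForm.canalizes {F : BoolFn (Fin n)} (hF : S.OuterForm l F)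
    (hk : S.kind l = BlockKind.andOr) (hi : i ∈ rowsTwo (S.Z l)) :
    Canalizes F i (toSign (S.D i)) 1 := by
  intro x hx
  simp only [OuterForm, hk] at hF
  apply val_injective
  rw [hF, Finset.prod_eq_zero hi, mul_zero, zero_mul, zero_sub, val_neg, val_one]
  rw [hx, mul_neg_toSign (S.andOr_row l hk i hi).1]

section Block

variable {f : Fin m → BoolFn (Fin n)} {g : Fin n → BoolFn (Fin m)}
  {F : BoolFn (Fin n)} {G : BoolFn (Fin m)}

/-- If no row function and no column function of an AND/OR-like block takes its canalized value,
then the inner function of the block is `1`. -/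
lemma outer_rowVals_eq_one (hk : S.kind l = BlockKind.andOr)
    (hf : ∀ j ∈ cols (S.Z l), S.ColForm l j (f j))
    (hg : ∀ i ∈ rows (S.Z l), S.transpose.ColForm l i (g i)) (hF : S.OuterForm l F)
    {z : Cube (Fin n × Fin m)} (hr : ∀ i ∈ rowsTwo (S.Z l), rowVals g z i = toSign (S.D i))
    (hc : ∀ j ∈ colsTwo (S.Z l), colVals f z j = toSign (S.B j)) : F (rowVals g z) = 1 := by
  simp only [OuterForm, hk] at hF
  apply val_injective
  rw [hF, Finset.prod_eq_one, Finset.prod_eq_one, val_one]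
  · norm_num
  · intro j hj
    rw [phiAt_xSgn_rowVals hg (colsTwo_subset_cols hj)]
    exact (hf j (colsTwo_subset_cols hj)).phiAt_eq_one hk hj (hc j hj)
  · intro i hi
    rw [hr i hi, mul_toSign (S.andOr_row l hk i hi).1]

/-! ### Uniqueness of the outer functions on a block -/

variable (S) in
/-- Any two positions in the same block are joined by a path in the graph of all positions. -/
def BlocksConnected : Prop :=
  ∀ p q : {p : Fin n × Fin m // p ∈ S.Z₀}, (∃ l, p.1 ∈ S.Z l ∧ q.1 ∈ S.Z l) →
    (entryGraph S.Z₀).Reachable p q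

/-- A property of positions that spreads along the rows and the columns with at least two elements
spreads over a connected block. -/
lemma BlocksConnected.induction (hS : S.BlocksConnected) {C : Fin n × Fin m → Prop}
    (hrow : ∀ i j j', (i, j) ∈ S.Z l → (i, j') ∈ S.Z l → i ∈ rowsTwo S.Z₀ → C (i, j) → C (i, j'))
    (hcol : ∀ i i' j, (i, j) ∈ S.Z l → (i', j) ∈ S.Z l → j ∈ colsTwo S.Z₀ → C (i, j) → C (i', j))
    {p q : Fin n × Fin m} (hp : p ∈ S.Z l) (hq : q ∈ S.Z l) (hC : C p) : C q := by
  refine (reachable_induction (C := fun p => p ∈ S.Z l ∧ C p) ?_ ?_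
    (hS ⟨p, mem_Z₀_of_mem hp⟩ ⟨q, mem_Z₀_of_mem hq⟩ ⟨l, hp, hq⟩) ⟨hp, hC⟩).2
  · rintro i j j' - hij' hi ⟨hij, h⟩
    have hl := mem_Z_of_mem_rows (mem_rows.2 ⟨j, hij⟩) hij'
    exact ⟨hl, hrow i j j' hij hl hi h⟩
  · rintro i i' j - hij' hj ⟨hij, h⟩
    have hl := mem_Z_of_mem_cols (mem_cols.2 ⟨i, hij⟩) hij'
    exact ⟨hl, hcol i i' j hij hl hj h⟩

/-- If quantities attached to the rows and to the columns agree at the positions that are alone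
neither in their row nor in their column, then they all agree within a connected block. -/
lemma BlocksConnected.exists_common_value (hS : S.BlocksConnected) {X : Type*} (U : Fin n → X)
    (V : Fin m → X) (hUV : ∀ i j, (i, j) ∈ S.Z l → i ∈ rowsTwo S.Z₀ → j ∈ colsTwo S.Z₀ →
      U i = V j) :
    ∃ Ψ, ∀ i j, (i, j) ∈ S.Z l →
      (i ∈ rowsTwo S.Z₀ → U i = Ψ) ∧ (j ∈ colsTwo S.Z₀ → V j = Ψ) := by
  obtain ⟨⟨a, b⟩, hab⟩ := S.nonempty l
  have key : ∀ Ψ, ((a ∈ rowsTwo S.Z₀ → U a = Ψ) ∧ (b ∈ colsTwo S.Z₀ → V b = Ψ)) →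
      ∀ i j, (i, j) ∈ S.Z l →
      (i ∈ rowsTwo S.Z₀ → U i = Ψ) ∧ (j ∈ colsTwo S.Z₀ → V j = Ψ) := by
    intro Ψ h0 i j hij
    refine hS.induction (l := l) (C := fun p => (p.1 ∈ rowsTwo S.Z₀ → U p.1 = Ψ) ∧
      (p.2 ∈ colsTwo S.Z₀ → V p.2 = Ψ)) ?_ ?_ hab hij h0
    · intro i j j' _ hij' hi hC
      exact ⟨hC.1, fun hj' => (hUV i j' hij' hi hj').symm.trans (hC.1 hi)⟩
    · intro i i' j _ hij' hj hC
      exact ⟨fun hi' => (hUV i' j hij' hi' hj).trans (hC.2 hj), hC.2⟩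
  by_cases ha : a ∈ rowsTwo S.Z₀
  · exact ⟨U a, key _ ⟨fun _ => rfl, fun hb => (hUV a b hab ha hb).symm⟩⟩
  · exact ⟨V b, key _ ⟨fun h => absurd h ha, fun _ => rfl⟩⟩

lemma mem_rowsTwo_or_mem_colsTwo (hk : S.kind l ≠ BlockKind.singleton) (hij : (i, j) ∈ S.Z l) :
    i ∈ rowsTwo S.Z₀ ∨ j ∈ colsTwo S.Z₀ :=
  (S.not_isolated l (fun h => hk ((S.kind_singleton l).2 h)) i j hij).imp
    (mem_rowsTwo_block (mem_rows.2 ⟨j, hij⟩)).1 (mem_colsTwo_block (mem_cols.2 ⟨i, hij⟩)).1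

variable {f₀ : BoolFn (Fin n)} {g₀ : BoolFn (Fin m)}

/-- In an XOR-like block, flipping the input of `f₀` at any row with at least two elements and
flipping the input of `g₀` at any such column have the same effect `Ψ` on the composition. Flipping
a position of the block interchanges the composition with `Ψ` exactly if it changes the inner
function of the block. -/
lemma rowComp_eq_of_outer_eq_xor (hP : IsGeneralizedPolymorphism f₀ f g₀ g)
    (hS : S.BlocksConnected) (hk : S.kind l = BlockKind.xor)
    (hf : ∀ j ∈ cols (S.Z l), S.ColForm l j (f j))
    (hg : ∀ i ∈ rows (S.Z l), S.transpose.ColForm l i (g i)) (hF : S.OuterForm l F)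
    (hG : S.transpose.OuterForm l G) {w w' : Cube (Fin n × Fin m)}
    (hw : ∀ p, p ∉ S.Z l → w p = w' p) (hww : F (rowVals g w) = F (rowVals g w')) :
    f₀ (rowVals g w) = f₀ (rowVals g w') := by
  have hfo : ∀ i j, (i, j) ∈ S.Z l → i ∈ rowsTwo S.Z₀ → OddAt (f j) i := fun i j hij hi =>
    (hf j (mem_cols.2 ⟨i, hij⟩)).oddAt hk (mem_Z₀_of_mem hij) hi
  have hgo : ∀ i j, (i, j) ∈ S.Z l → j ∈ colsTwo S.Z₀ → OddAt (g i) j := fun i j hij hj =>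
    (hg i (mem_rows.2 ⟨j, hij⟩)).oddAt hk
      (by rw [transpose_Z₀, mem_transposeSet]; exact mem_Z₀_of_mem hij)
      (by rwa [transpose_Z₀, rowsTwo_transposeSet])
  have hFo : ∀ i j, (i, j) ∈ S.Z l → i ∈ rowsTwo S.Z₀ → OddAt F i := fun i j hij hi =>
    hF.oddAt hk ((mem_rowsTwo_block (mem_rows.2 ⟨j, hij⟩)).2 hi)
  have hGo : ∀ i j, (i, j) ∈ S.Z l → j ∈ colsTwo S.Z₀ → OddAt G j := fun i j hij hj =>
    hG.oddAt hk (by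
      rw [transpose_Z, rowsTwo_transposeSet]
      exact (mem_colsTwo_block (mem_cols.2 ⟨i, hij⟩)).2 hj)
  have hFG := outer_rowVals_eq_outer_colVals hf hg hF hG
  have hsens : ∀ {ι : Type} [DecidableEq ι] {u : BoolFn ι} {a : ι} (x : Cube ι), OddAt u a →
      SensAt u a x := fun x h => Int.units_ne_iff_eq_neg.2 (h x)
  obtain ⟨Ψ, hΨ⟩ := hS.exists_common_value (l := l)
    (fun i z => f₀ (flip i (rowVals g z))) (fun j z => g₀ (flip j (colVals f z))) (by
      intro i j hij hi hj
      funext z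
      rw [← rowVals_flip_of_sensAt (hsens (fun j => z (i, j)) (hgo i j hij hj)),
        ← colVals_flip_of_sensAt (hsens (fun i => z (i, j)) (hfo i j hij hi)),
        hP.rowVals_eq_colVals])
  -- the effect of a flip on the composition, on `Ψ` and on the inner function
  have hflip : ∀ p ∈ S.Z l, ∀ z,
      (f₀ (rowVals g (flip p z)) = Ψ z ∧ Ψ (flip p z) = f₀ (rowVals g z) ∧
        F (rowVals g (flip p z)) = -F (rowVals g z)) ∨
      (f₀ (rowVals g (flip p z)) = f₀ (rowVals g z) ∧ Ψ (flip p z) = Ψ z ∧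
        F (rowVals g (flip p z)) = F (rowVals g z)) := by
    rintro ⟨i, j⟩ hij z
    rcases mem_rowsTwo_or_mem_colsTwo (by rw [hk]; simp) hij with hi | hj
    · rw [← (hΨ i j hij).1 hi]
      by_cases hs : SensAt (g i) j fun j' => z (i, j')
      · simp [rowVals_flip_of_sensAt hs, flip_flip, hFo i j hij hi _]
      · simp [rowVals_flip_of_not_sensAt hs]
    · rw [← (hΨ i j hij).2 hj]
      simp only [hFG, hP.rowVals_eq_colVals]
      by_cases hs : SensAt (f j) i fun i' => z (i', j)
      · simp [colVals_flip_of_sensAt hs, flip_flip, hGo i j hij hj _]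
      · simp [colVals_flip_of_not_sensAt hs]
  have hinv : ∀ s : ℤˣ, (if F (rowVals g w) = s then f₀ (rowVals g w) else Ψ w) =
      if F (rowVals g w') = s then f₀ (rowVals g w') else Ψ w' := by
    intro s
    refine eq_of_flip_invariant
      (fun z => if F (rowVals g z) = s then f₀ (rowVals g z) else Ψ z) (S.Z l) ?_ hw
    intro p hp z
    rcases hflip p hp z with ⟨h1, h2, h3⟩ | ⟨h1, h2, h3⟩
    · rw [h1, h2, h3]
      by_cases h : F (rowVals g z) = s
      · rw [if_pos h, if_neg (by rw [h]; exact (units_ne_neg_self s).symm)]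
      · rw [if_neg h, if_pos (by rw [Int.units_ne_iff_eq_neg.1 h, neg_neg])]
    · rw [h1, h2, h3]
  have := hinv (F (rowVals g w))
  rwa [if_pos rfl, if_pos hww.symm] at this

/-- In an AND/OR-like block, setting the input of `f₀` at any row with at least two elements and
setting the input of `g₀` at any such column to the canalized value have the same effect `Ψ` on the
composition. As every position of the block lies in such a row or column, `Ψ` does not depend on the
block at all. If the inner function of the block is `-1`, then some input has its canalized value
and the composition is `Ψ`. If it is `1` at two matrices, the matrix that combines the rows of the
first with at least two elements and the other rows of the second has the column values of the first
and the row values of the second. -/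
lemma rowComp_eq_of_outer_eq_andOr (hP : IsGeneralizedPolymorphism f₀ f g₀ g)
    (hdep : ∀ i j, i ∈ dep (f j) → (i, j) ∈ S.Z₀)
    (hS : S.BlocksConnected) (hk : S.kind l = BlockKind.andOr)
    (hf : ∀ j ∈ cols (S.Z l), S.ColForm l j (f j))
    (hg : ∀ i ∈ rows (S.Z l), S.transpose.ColForm l i (g i)) (hF : S.OuterForm l F)
    (hG : S.transpose.OuterForm l G) {w w' : Cube (Fin n × Fin m)}
    (hw : ∀ p, p ∉ S.Z l → w p = w' p) (hww : F (rowVals g w) = F (rowVals g w')) :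
    f₀ (rowVals g w) = f₀ (rowVals g w') := by
  have hfc : ∀ i j, (i, j) ∈ S.Z l → i ∈ rowsTwo S.Z₀ → j ∈ colsTwo S.Z₀ →
      Canalizes (f j) i (toSign (S.κ i j)) (toSign (S.B j)) := fun i j hij hi hj =>
    (hf j (mem_cols.2 ⟨i, hij⟩)).canalizes hk (mem_Z₀_of_mem hij)
      ((mem_colsTwo_block (mem_cols.2 ⟨i, hij⟩)).2 hj) hi
  have hgc : ∀ i j, (i, j) ∈ S.Z l → i ∈ rowsTwo S.Z₀ → j ∈ colsTwo S.Z₀ →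
      Canalizes (g i) j (toSign (S.κ i j)) (toSign (S.D i)) := fun i j hij hi hj =>
    (hg i (mem_rows.2 ⟨j, hij⟩)).canalizes (S := S.transpose) hk
      (by rw [transpose_Z₀, mem_transposeSet]; exact mem_Z₀_of_mem hij)
      (by rw [transpose_Z, colsTwo_transposeSet]
          exact (mem_rowsTwo_block (mem_rows.2 ⟨j, hij⟩)).2 hi)
      (by rwa [transpose_Z₀, rowsTwo_transposeSet])
  have hFG := outer_rowVals_eq_outer_colVals hf hg hF hG
  rcases Int.units_eq_one_or (F (rowVals g w)) with h1 | h1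
  · have h1' := h1
    rw [hww] at h1'
    have hrow : ∀ z, F (rowVals g z) = 1 → ∀ i ∈ rows (S.Z l), i ∈ rowsTwo S.Z₀ →
        rowVals g z i = toSign (S.D i) := fun z hz i hi hi' =>
      (hF.canalizes hk ((mem_rowsTwo_block hi).2 hi')).eq_of_apply hz
    have hcol : ∀ z, F (rowVals g z) = 1 → ∀ j ∈ cols (S.Z l), j ∈ colsTwo S.Z₀ →
        colVals f z j = toSign (S.B j) := fun z hz j hj hj' =>
      (hG.canalizes (S := S.transpose) hk (by
        rw [transpose_Z, rowsTwo_transposeSet]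
        exact (mem_colsTwo_block hj).2 hj')).eq_of_apply ((hFG z).symm.trans hz)
    let v : Cube (Fin n × Fin m) := fun p => if p.1 ∈ rowsTwo S.Z₀ then w p else w' p
    have hvr : rowVals g v = rowVals g w' := by
      ext i
      by_cases hi : i ∈ rowsTwo S.Z₀
      · have h2 : rowVals g v i = rowVals g w i := by simp [rowVals, v, hi]
        rw [h2]
        by_cases hil : i ∈ rows (S.Z l)
        · rw [hrow w h1 i hil hi, hrow w' h1' i hil hi]
        · exact congrArg _ (congrArg (g i) (funext fun j =>
            hw _ fun h => hil (mem_rows.2 ⟨j, h⟩)))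
      · simp [rowVals, v, hi]
    have hvc : colVals f v = colVals f w := by
      ext j
      by_cases hjl : j ∈ cols (S.Z l)
      · rcases (by
          obtain ⟨i, hi⟩ := mem_cols.1 hjl
          exact colsOne_or_colsTwo (mem_Z₀_of_mem hi) :
            j ∈ colsOne S.Z₀ ∨ j ∈ colsTwo S.Z₀) with hj | hj
        · -- the single element of the column lies in a row with at least two elements
          refine congrArg _ (apply_congr_dep fun i hi => ?_)
          have hl := mem_Z_of_mem_cols hjl (hdep i j hi)
          have hi' := (mem_rowsTwo_or_mem_colsTwo (by rw [hk]; simp) hl).resolve_right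
            (notMem_colsTwo_of_colsOne hj)
          simp [v, hi']
        · have h2 : colVals f v j = colVals f w' j := by
            refine apply_congr_dep fun i hi => ?_
            have hl := mem_Z_of_mem_cols hjl (hdep i j hi)
            by_cases hi' : i ∈ rowsTwo S.Z₀
            · have h3 := (hfc i j hl hi' hj).eq_of_apply (hcol w h1 j hjl hj)
              have h4 := (hfc i j hl hi' hj).eq_of_apply (hcol w' h1' j hjl hj)
              simp only [v, hi', if_true]
              rw [h3, h4]
            · simp [v, hi']
          rw [h2, hcol w h1 j hjl hj, hcol w' h1' j hjl hj]
      · refine congrArg _ (congrArg (f j) (funext fun i => ?_))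
        simp only [v]
        split_ifs
        · rfl
        · exact (hw _ fun h => hjl (mem_cols.2 ⟨i, h⟩)).symm
    rw [hP.rowVals_eq_colVals, ← hvc, ← hP.rowVals_eq_colVals, hvr]
  · obtain ⟨Ψ, hΨ⟩ := hS.exists_common_value (l := l)
      (fun i z => f₀ (Function.update (rowVals g z) i (-toSign (S.D i))))
      (fun j z => g₀ (Function.update (colVals f z) j (-toSign (S.B j)))) (by
        intro i j hij hi hj
        funext z
        let v : Cube (Fin n × Fin m) := Function.update z (i, j) (-toSign (S.κ i j))
        have hr : rowVals g v = Function.update (rowVals g z) i (-toSign (S.D i)) := by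
          ext a
          by_cases ha : a = i
          · subst ha
            rw [Function.update_self]
            exact congrArg _ (hgc a j hij hi hj _ (by simp [v]))
          · simp [rowVals, v, ha]
        have hc : colVals f v = Function.update (colVals f z) j (-toSign (S.B j)) := by
          ext a
          by_cases ha : a = j
          · subst ha
            rw [Function.update_self]
            exact congrArg _ (hfc i a hij hi hj _ (by simp [v]))
          · simp [colVals, v, ha]
        rw [← hr, ← hc, hP.rowVals_eq_colVals])
    have hΨw : Ψ w = Ψ w' := by
      refine eq_of_flip_invariant Ψ (S.Z l) ?_ hw
      rintro ⟨i, j⟩ hij z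
      rcases mem_rowsTwo_or_mem_colsTwo (by rw [hk]; simp) hij with hi | hj
      · rw [← (hΨ i j hij).1 hi]
        dsimp only
        rw [rowVals_flip, Function.update_idem]
      · rw [← (hΨ i j hij).2 hj]
        dsimp only
        rw [colVals_flip, Function.update_idem]
    have key : ∀ z, F (rowVals g z) = -1 → f₀ (rowVals g z) = Ψ z := by
      intro z hz
      by_contra hne
      have h2 : F (rowVals g z) = 1 := by
        refine outer_rowVals_eq_one hk hf hg hF (fun i hi => ?_) fun j hj => ?_
        · obtain ⟨j, hij⟩ := mem_rows.1 (rowsTwo_subset_rows hi)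
          by_contra h3
          refine hne ?_
          rw [← (hΨ i j hij).1 ((mem_rowsTwo_block (rowsTwo_subset_rows hi)).1 hi)]
          dsimp only
          rw [← Int.units_ne_iff_eq_neg.1 h3, Function.update_eq_self]
        · obtain ⟨i, hij⟩ := mem_cols.1 (colsTwo_subset_cols hj)
          by_contra h3
          refine hne ?_
          rw [← (hΨ i j hij).2 ((mem_colsTwo_block (colsTwo_subset_cols hj)).1 hj)]
          dsimp only
          rw [← Int.units_ne_iff_eq_neg.1 h3, Function.update_eq_self, hP.rowVals_eq_colVals]
      rw [hz] at h2
      exact absurd h2 (by decide)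
    rw [key w h1, key w' (hww ▸ h1), hΨw]

/-- On a connected block, the composition `f₀ ∘ g` depends on the block only through the value of
the inner function of the block. -/
theorem rowComp_eq_of_outer_eq (hP : IsGeneralizedPolymorphism f₀ f g₀ g)
    (hdep : ∀ i j, i ∈ dep (f j) → (i, j) ∈ S.Z₀)
    (hS : S.BlocksConnected)
    (hf : ∀ j ∈ cols (S.Z l), S.ColForm l j (f j))
    (hg : ∀ i ∈ rows (S.Z l), S.transpose.ColForm l i (g i)) (hF : S.OuterForm l F)
    (hG : S.transpose.OuterForm l G) {w w' : Cube (Fin n × Fin m)}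
    (hw : ∀ p, p ∉ S.Z l → w p = w' p) (hww : F (rowVals g w) = F (rowVals g w')) :
    f₀ (rowVals g w) = f₀ (rowVals g w') := by
  rcases hk : S.kind l with _ | _ | _
  · obtain ⟨⟨i, j⟩, hp⟩ := Finset.card_eq_one.1 ((S.kind_singleton l).1 hk)
    simp only [OuterForm, hk] at hF
    have hij : (i, j) ∈ S.Z l := by simp [hp]
    rw [hF i j hij, hF i j hij, mul_right_inj] at hww
    refine congrArg f₀ (funext fun a => ?_)
    by_cases ha : a = i
    · rw [ha, hww]
    · exact congrArg (g a) (funext fun b => hw _ (by simp [hp, ha]))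
  · exact rowComp_eq_of_outer_eq_xor hP hS hk hf hg hF hG hw hww
  · exact rowComp_eq_of_outer_eq_andOr hP hdep hS hk hf hg hF hG hw hww

end Block

end SolutionData

/-! ### Formulas for the inner functions of a reduced generalized polymorphism -/

section Formulas

variable {ι : Type} [DecidableEq ι]

/-- The vector that agrees with `x` on `s` and with `e` outside `s`. -/
def mix (s : Finset ι) (e x : Cube ι) : Cube ι := fun i => if i ∈ s then x i else e i

variable [Fintype ι]

/-- The odd coordinates of a Boolean function split off as a product. -/
lemma val_eq_mul_prod_of_oddAt {u : BoolFn ι} {s t : Finset ι} (hst : Disjoint s t)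
    (hdep : dep u ⊆ s ∪ t) (hodd : ∀ i ∈ t, OddAt u i) (x : Cube ι) :
    val (u x) = val (u (mix s 1 x)) * ∏ i ∈ t, val (x i) := by
  have h1 : val (u x) * ∏ i ∈ t, val (x i) =
      val (u (mix s 1 x)) * ∏ i ∈ t, val (mix s 1 x i) := by
    refine eq_of_flip_invariant (fun y => val (u y) * ∏ i ∈ t, val (y i)) sᶜ (fun i hi y => ?_)
      fun i hi => ?_
    · by_cases hit : i ∈ t
      · rw [hodd i hit, prod_val_flip hit, val_neg, neg_mul_neg]
      · rw [prod_val_flip_of_notMem hit, apply_flip_of_notMem_dep (f := u) fun h => ?_]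
        rcases Finset.mem_union.1 (hdep h) with h | h
        · exact Finset.mem_compl.1 hi h
        · exact hit h
    · rw [Finset.mem_compl, not_not] at hi
      simp [mix, hi]
  have h2 : ∏ i ∈ t, val (mix s 1 x i) = 1 := Finset.prod_eq_one fun i hi => by
    rw [mix, if_neg fun h => Finset.disjoint_left.1 hst h hi, Pi.one_apply, val_one]
  have h3 : (∏ i ∈ t, val (x i)) * ∏ i ∈ t, val (x i) = 1 := by
    rw [← Finset.prod_mul_distrib]
    exact Finset.prod_eq_one fun i _ => val_mul_self _
  rw [h2, mul_one] at h1
  rw [← h1, mul_assoc, h3, mul_one]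

/-- The canalizing coordinates of a Boolean function split off as an AND/OR. -/
lemma val_eq_of_canalizes {u : BoolFn ι} {s t : Finset ι}
    (hdep : dep u ⊆ s ∪ t) {e : Cube ι} {b : ℤˣ} (hc : ∀ i ∈ t, Canalizes u i (e i) b)
    (x : Cube ι) :
    val (u x) = (if u (mix s e x) = b then 1 else 0) * (2 * val b) *
      (∏ i ∈ t, (val (e i) * val (x i) + 1) / 2) - val b := by
  by_cases h : ∀ i ∈ t, x i = e i
  · have h1 : u (mix s e x) = u x := by
      refine apply_congr_dep fun i hi => ?_
      rcases Finset.mem_union.1 (hdep hi) with his | hit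
      · simp [mix, his]
      · simp [mix, h i hit]
    rw [Finset.prod_eq_one fun i hi => by rw [h i hi, val_mul_self]; norm_num, h1]
    split_ifs with hb
    · rw [hb]; ring
    · rw [Int.units_ne_iff_eq_neg.1 hb, val_neg]; ring
  · push Not at h
    obtain ⟨i, hi, hx⟩ := h
    have hx := Int.units_ne_iff_eq_neg.1 hx
    rw [Finset.prod_eq_zero hi (by rw [hx, val_neg, mul_neg, val_mul_self]; norm_num),
      hc i hi x hx, val_neg]
    ring

end Formulas

section Data

variable {n m : ℕ}

/-- The common canalizing value of `f j` at the coordinate `i` and of `g i` at the coordinate `j`,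
and an arbitrary sign if there is none. -/
noncomputable def commonValue (f : Fin m → BoolFn (Fin n)) (g : Fin n → BoolFn (Fin m))
    (i : Fin n) (j : Fin m) : ℤˣ :=
  Classical.epsilon fun κ => (∃ c, Canalizes (f j) i κ c) ∧ ∃ c, Canalizes (g i) j κ c

/-- The value of `f j` that requires the canalizing values in all canalizing coordinates, found as
the opposite of the value that is forced when all of them are violated. -/
noncomputable def openValue (f : Fin m → BoolFn (Fin n)) (g : Fin n → BoolFn (Fin m))
    (j : Fin m) : ℤˣ :=
  -f j fun i => -commonValue f g i j

lemma commonValue_comm (f : Fin m → BoolFn (Fin n)) (g : Fin n → BoolFn (Fin m))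
    (i : Fin n) (j : Fin m) : commonValue g f j i = commonValue f g i j := by
  simp only [commonValue, and_comm]

open Classical in
/-- The function of `x` embedded in the formula for `f j`: the indicator function of the open value
if `j` is a canalizing column, and otherwise the sign left over when the odd coordinates are
split off. It only sees the coordinates in `s`. -/
noncomputable def embedded (f : Fin m → BoolFn (Fin n)) (g : Fin n → BoolFn (Fin m))
    (s : Finset (Fin n)) (j : Fin m) (x : Cube (Fin n)) : ℝ :=
  if CanalizingRow g f j then
    if f j (mix s (fun i => commonValue f g i j) x) = openValue f g j then 1 else 0
  else val (f j (mix s 1 x))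

lemma embedded_congr {f : Fin m → BoolFn (Fin n)} {g : Fin n → BoolFn (Fin m)}
    {s : Finset (Fin n)} {j : Fin m} {x y : Cube (Fin n)} (h : ∀ i ∈ s, x i = y i) :
    embedded f g s j x = embedded f g s j y := by
  have h1 : ∀ e : Cube (Fin n), mix s e x = mix s e y := fun e => funext fun i => by
    by_cases hi : i ∈ s
    · simp [mix, hi, h i hi]
    · simp [mix, hi]
  simp only [embedded, h1]

lemma embedded_eq_zero_or_one {f : Fin m → BoolFn (Fin n)} {g : Fin n → BoolFn (Fin m)}
    {s : Finset (Fin n)} {j : Fin m} (hj : CanalizingRow g f j) (x : Cube (Fin n)) :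
    embedded f g s j x = 0 ∨ embedded f g s j x = 1 := by
  rw [embedded, if_pos hj]
  split_ifs <;> simp

lemma embedded_eq_one_or_neg_one {f : Fin m → BoolFn (Fin n)} {g : Fin n → BoolFn (Fin m)}
    {s : Finset (Fin n)} {j : Fin m} (hj : ¬ CanalizingRow g f j) (x : Cube (Fin n)) :
    embedded f g s j x = 1 ∨ embedded f g s j x = -1 := by
  rw [embedded, if_neg hj]
  exact val_eq_one_or _

lemma embedded_empty {f : Fin m → BoolFn (Fin n)} {g : Fin n → BoolFn (Fin m)}
    {j : Fin m} (hj : ¬ CanalizingRow g f j) (x : Cube (Fin n)) :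
    embedded f g ∅ j x = val (f j 1) := by
  rw [embedded, if_neg hj]
  refine congrArg (fun y => val (f j y)) (funext fun i => ?_)
  simp [mix]

namespace IsReduced

variable {f₀ : BoolFn (Fin n)} {f : Fin m → BoolFn (Fin n)} {g₀ : BoolFn (Fin m)}
  {g : Fin n → BoolFn (Fin m)} {i i' : Fin n} {j j' : Fin m}

lemma canalizes_openValue (h : IsReduced f₀ f g₀ g) (hi : CanalizingRow f g i)
    (hj : CanalizingRow g f j) (hij : i ∈ dep (f j)) :
    Canalizes (f j) i (commonValue f g i j) (openValue f g j) := by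
  have hex := h.exists_common_canalizes hi (h.mem_dep_g_iff_mem_dep_f.2 hij) hj.1
  obtain ⟨c, hc⟩ : ∃ c, Canalizes (f j) i (commonValue f g i j) c :=
    (Classical.epsilon_spec hex).1
  have h1 : openValue f g j = c := by rw [openValue, hc _ rfl, neg_neg]
  rwa [h1]

/-- The canalizing property of rows and columns is constant on the components. -/
lemma canalizing_of_reachable (h : IsReduced f₀ f g₀ g) {W : Finset (Fin n × Fin m)}
    (hW : ∀ i j, (i, j) ∈ W ↔ i ∈ dep (f j)) {p q : {p : Fin n × Fin m // p ∈ W}}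
    (hpq : (entryGraph W).Reachable p q)
    (hp : CanalizingRow f g p.1.1 ∨ CanalizingRow g f p.1.2) :
    CanalizingRow f g q.1.1 ∨ CanalizingRow g f q.1.2 := by
  have hr : ∀ i, rowEntries W i = dep (g i) := fun i => by
    ext j; rw [mem_rowEntries, hW, h.mem_dep_g_iff_mem_dep_f]
  have hc : ∀ j, colEntries W j = dep (f j) := fun j => by ext i; rw [mem_colEntries, hW]
  refine reachable_induction
    (C := fun p => CanalizingRow f g p.1 ∨ CanalizingRow g f p.2) ?_ ?_ hpq hp
  · rintro i j j' hij _ hi (h1 | h1)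
    · exact Or.inl h1
    · rw [mem_rowsTwo, hr] at hi
      exact Or.inl (h.transpose.canalizingRow_transpose h1 ((hW i j).1 hij) hi)
  · rintro i i' j hij _ hj (h1 | h1)
    · rw [mem_colsTwo, hc] at hj
      exact Or.inr (h.canalizingRow_transpose h1
        (h.mem_dep_g_iff_mem_dep_f.2 ((hW i j).1 hij)) hj)
    · exact Or.inr h1

end IsReduced

namespace SolutionData

variable {k : ℕ} {S : SolutionData n m k} {l : Fin k} {j : Fin m} {f₀ : BoolFn (Fin n)}
  {f : Fin m → BoolFn (Fin n)} {g₀ : BoolFn (Fin m)} {g : Fin n → BoolFn (Fin m)}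

/-- The column functions of a reduced generalized polymorphism have the form given by solution data
built from the common canalizing values, the open values and the embedded functions. -/
lemma colForm_of_isReduced (h : IsReduced f₀ f g₀ g)
    (hmem : ∀ i j, (i, j) ∈ S.Z₀ ↔ i ∈ dep (f j)) (hsgn : ∀ j, S.sgnF j = f j 1)
    (hφ : ∀ j x, S.phiAt j x = embedded f g (colDepOne S.Z₀ j) j x)
    (hB : ∀ j, CanalizingRow g f j → S.B j = val (openValue f g j))
    (hκ : ∀ i j, (i, j) ∈ S.Z₀ → CanalizingRow f g i → CanalizingRow g f j →
      S.κ i j = val (commonValue f g i j))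
    (hxor : ∀ l, S.kind l = BlockKind.xor → ∀ i j, (i, j) ∈ S.Z l →
      ¬ CanalizingRow f g i ∧ ¬ CanalizingRow g f j)
    (hand : ∀ l, S.kind l = BlockKind.andOr → ∀ i j, (i, j) ∈ S.Z l →
      (i ∈ rowsTwo S.Z₀ → CanalizingRow f g i) ∧ (j ∈ colsTwo S.Z₀ → CanalizingRow g f j))
    (hj : j ∈ cols (S.Z l)) : S.ColForm l j (f j) := by
  have hcol : ∀ j, colEntries S.Z₀ j = dep (f j) := fun j => by ext i; rw [mem_colEntries, hmem]
  have hrow : ∀ i, rowEntries S.Z₀ i = dep (g i) := fun i => by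
    ext j; rw [mem_rowEntries, hmem, h.mem_dep_g_iff_mem_dep_f]
  have hone : j ∈ colsOne (S.Z l) → ∀ i, (i, j) ∈ S.Z l → ∀ x, f j x = S.sgnF j * x i := by
    intro hj1 i hij x
    rw [hsgn]
    refine (h.f_nonConstant j).eq_mul_of_dep_eq_singleton ?_ x
    rw [← hcol]
    exact colEntries_of_colsOne (mem_Z₀_of_mem hij) ((mem_colsOne_block hj).1 hj1)
  have hdisj : Disjoint (colDepOne S.Z₀ j) (colDepTwo S.Z₀ j) := by
    refine Finset.disjoint_left.2 fun i h1 h2 => ?_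
    exact notMem_rowsTwo_of_rowsOne (mem_colDepOne.1 h1).2 (mem_colDepTwo.1 h2).2
  have hdep : dep (f j) ⊆ colDepOne S.Z₀ j ∪ colDepTwo S.Z₀ j := by
    intro i hi
    have hij := (hmem i j).2 hi
    rw [Finset.mem_union, mem_colDepOne, mem_colDepTwo]
    exact (rowsOne_or_rowsTwo hij).imp (fun h => ⟨hij, h⟩) fun h => ⟨hij, h⟩
  unfold ColForm
  rcases hk : S.kind l with _ | _ | _ <;> dsimp only
  · intro i hij
    obtain ⟨p, hp⟩ := Finset.card_eq_one.1 ((S.kind_singleton l).1 hk)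
    refine hone (mem_colsOne.2 ?_) i hij
    have h1 : colEntries (S.Z l) j = {i} := by
      ext a
      rw [mem_colEntries, Finset.mem_singleton]
      refine ⟨fun ha => ?_, fun ha => ha ▸ hij⟩
      rw [hp, Finset.mem_singleton] at ha hij
      exact (Prod.mk.inj (ha.trans hij.symm)).1
    rw [h1, Finset.card_singleton]
  · obtain ⟨i, hij⟩ := mem_cols.1 hj
    intro x
    rw [hφ, embedded, if_neg (hxor l hk i j hij).2]
    refine val_eq_mul_prod_of_oddAt hdisj hdep (fun a ha => ?_) x
    obtain ⟨haj, ha⟩ := mem_colDepTwo.1 ha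
    refine h.oddAt_of_not_canalizingRow (hrow a ▸ mem_rowsTwo.1 ha)
      (hxor l hk a j (mem_Z_of_mem_cols hj haj)).1 ?_
    exact h.mem_dep_g_iff_mem_dep_f.2 ((hmem a j).1 haj)
  · refine ⟨hone, fun hj2 x => ?_⟩
    obtain ⟨i, hij⟩ := mem_cols.1 hj
    have hcj := (hand l hk i j hij).2 ((mem_colsTwo_block hj).1 hj2)
    have hci : ∀ a ∈ colDepTwo S.Z₀ j, CanalizingRow f g a := fun a ha =>
      (hand l hk a j (mem_Z_of_mem_cols hj (mem_colDepTwo.1 ha).1)).1 (mem_colDepTwo.1 ha).2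
    rw [hφ, embedded, if_pos hcj, hB j hcj, Finset.prod_congr rfl fun a ha => by
      rw [hκ a j (mem_colDepTwo.1 ha).1 (hci a ha) hcj]]
    exact val_eq_of_canalizes hdep (fun a ha => h.canalizes_openValue (hci a ha) hcj
      ((hmem a j).1 (mem_colDepTwo.1 ha).1)) x

end SolutionData

end Data

namespace SolutionData

variable {n m k : ℕ} {S : SolutionData n m k} {l : Fin k}

/-! ### The outer function `h` -/

lemma xSgn_congr {x y : Cube (Fin n)} {i : Fin n} (h : x i = y i) : S.xSgn x i = S.xSgn y i := by
  simp only [xSgn, h]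

/-- The inner function of a block depends only on the rows of the block. -/
lemma OuterForm.congr {F : BoolFn (Fin n)} (hF : S.OuterForm l F) {x y : Cube (Fin n)}
    (h : ∀ i ∈ rows (S.Z l), x i = y i) : F x = F y := by
  have h1 : ∀ j ∈ colsTwo (S.Z l), S.phiAt j (S.xSgn x) = S.phiAt j (S.xSgn y) := fun j hj =>
    phiAt_congr fun i hij _ => xSgn_congr (h i (mem_rows.2
      ⟨j, mem_Z_of_mem_cols (colsTwo_subset_cols hj) hij⟩))
  have h2 : ∀ i ∈ rowsTwo (S.Z l), x i = y i := fun i hi => h i (rowsTwo_subset_rows hi)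
  unfold OuterForm at hF
  rcases hk : S.kind l with _ | _ | _ <;> simp only [hk] at hF
  · obtain ⟨⟨i, j⟩, hp⟩ := Finset.card_eq_one.1 ((S.kind_singleton l).1 hk)
    have hij : (i, j) ∈ S.Z l := by simp [hp]
    rw [hF i j hij, hF i j hij, h i (mem_rows.2 ⟨j, hij⟩)]
  · apply val_injective
    rw [hF, hF, Finset.prod_congr rfl h1, Finset.prod_congr rfl fun i hi => by rw [h2 i hi]]
  · apply val_injective
    rw [hF, hF, Finset.prod_congr rfl h1, Finset.prod_congr rfl fun i hi => by rw [h2 i hi]]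

variable {f₀ : BoolFn (Fin n)} {f : Fin m → BoolFn (Fin n)} {g₀ : BoolFn (Fin m)}
  {g : Fin n → BoolFn (Fin m)} {F : Fin k → BoolFn (Fin n)} {G : Fin k → BoolFn (Fin m)}

/-- The outer function `f₀` factors through the inner functions of the blocks: the rows of a matrix
can be changed block by block. -/
lemma apply_eq_of_forall_outer_eq (h : IsReduced f₀ f g₀ g)
    (hmem : ∀ i j, (i, j) ∈ S.Z₀ ↔ i ∈ dep (f j)) (hS : S.BlocksConnected)
    (hf : ∀ l, ∀ j ∈ cols (S.Z l), S.ColForm l j (f j))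
    (hg : ∀ l, ∀ i ∈ rows (S.Z l), S.transpose.ColForm l i (g i))
    (hF : ∀ l, S.OuterForm l (F l)) (hG : ∀ l, S.transpose.OuterForm l (G l))
    {x x' : Cube (Fin n)} (hx : ∀ l, F l x = F l x') : f₀ x = f₀ x' := by
  obtain ⟨z, rfl⟩ := rowVals_surjective h.g_nonConstant x
  obtain ⟨z', rfl⟩ := rowVals_surjective h.g_nonConstant x'
  -- the matrix with the entries of `z'` on the blocks in `T` and the entries of `z` elsewhere
  let v : Finset (Fin k) → Cube (Fin n × Fin m) := fun T p =>
    if ∃ l ∈ T, p ∈ S.Z l then z' p else z p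
  have hdisj : ∀ {l l' : Fin k} {p : Fin n × Fin m}, p ∈ S.Z l → p ∈ S.Z l' → l = l' := by
    intro l l' p hp hp'
    by_contra hne
    exact Finset.disjoint_left.1 (S.row_disjoint l l' hne) (mem_rows.2 ⟨p.2, hp⟩)
      (mem_rows.2 ⟨p.2, hp'⟩)
  have hmem' : ∀ i j, j ∈ dep (g i) → (i, j) ∈ S.Z₀ := fun i j hj =>
    (hmem i j).2 (h.mem_dep_g_iff_mem_dep_f.1 hj)
  have hvl : ∀ T l, F l (rowVals g (v T)) = if l ∈ T then F l (rowVals g z')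
      else F l (rowVals g z) := by
    intro T l
    have hv : ∀ i j, (i, j) ∈ S.Z l → v T (i, j) = if l ∈ T then z' (i, j) else z (i, j) := by
      intro i j hij
      have : (∃ l ∈ T, (i, j) ∈ S.Z l) ↔ l ∈ T :=
        ⟨fun ⟨l', hl', h'⟩ => hdisj hij h' ▸ hl', fun hl => ⟨l, hl, hij⟩⟩
      simp only [v, this]
    split_ifs with hl
    · refine (hF l).congr fun i hi => apply_congr_dep fun j hj => ?_
      rw [hv i j (mem_Z_of_mem_rows hi (hmem' i j hj)), if_pos hl]
    · refine (hF l).congr fun i hi => apply_congr_dep fun j hj => ?_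
      rw [hv i j (mem_Z_of_mem_rows hi (hmem' i j hj)), if_neg hl]
  have key : ∀ T, f₀ (rowVals g (v T)) = f₀ (rowVals g z) := by
    intro T
    induction T using Finset.induction_on with
    | empty => simp [v]
    | insert l T hl ih =>
      rw [← ih]
      refine rowComp_eq_of_outer_eq (l := l) h.gp (fun i j => (hmem i j).2) hS (hf l) (hg l) (hF l)
        (hG l) (fun p hp => ?_) ?_
      · simp [v, hp]
      · rw [hvl, hvl, if_pos (Finset.mem_insert_self l T), if_neg hl, hx]
  rw [← key Finset.univ]
  refine congrArg f₀ (funext fun i => apply_congr_dep fun j hj => ?_)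
  obtain ⟨l, -, hl⟩ := Finset.mem_biUnion.1 (hmem' i j hj)
  have : ∃ l ∈ Finset.univ, (i, j) ∈ S.Z l := ⟨l, Finset.mem_univ l, hl⟩
  simp only [v, this, if_true]

/-- An outer function that depends on all its inputs uses all the blocks. -/
lemma dep_eq_univ_of_factors (hdep : dep f₀ = Finset.univ) {u : BoolFn (Fin k)}
    (hF : ∀ l, S.OuterForm l (F l)) (hu : ∀ x, f₀ x = u fun l => F l x) :
    dep u = Finset.univ := by
  refine Finset.eq_univ_iff_forall.2 fun l => ?_
  obtain ⟨⟨i, j⟩, hij⟩ := S.nonempty l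
  obtain ⟨x, hx⟩ := mem_dep.1 (hdep ▸ Finset.mem_univ i : i ∈ dep f₀)
  rw [SensAt, hu, hu] at hx
  refine mem_dep.2 ⟨fun l => F l x, ?_⟩
  have h1 : ∀ l', l' ≠ l → F l' (flip i x) = F l' x := by
    refine fun l' hl' => (hF l').congr fun a ha => flip_ne (fun e => ?_) x
    subst e
    exact Finset.disjoint_left.1 (S.row_disjoint l' l hl') ha (mem_rows.2 ⟨j, hij⟩)
  rcases eq_or_eq_flip h1 with h2 | h2
  · exact absurd (congrArg u h2) hx
  · rwa [h2] at hx

end SolutionData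

/-! ### Solution data of a reduced generalized polymorphism -/

section Main

variable {n m : ℕ} {f₀ : BoolFn (Fin n)} {f : Fin m → BoolFn (Fin n)} {g₀ : BoolFn (Fin m)}
  {g : Fin n → BoolFn (Fin m)}

open Classical in
/-- Solution data for the inner functions of a reduced generalized polymorphism, with an arbitrary
outer function. -/
theorem IsReduced.exists_solutionData (h : IsReduced f₀ f g₀ g) :
    ∃ (k : ℕ) (S : SolutionData n m k), S.Z₀ = dep (rowComp f₀ g) ∧
      (∀ p q : {p : Fin n × Fin m // p ∈ S.Z₀},
        (∃ l, p.1 ∈ S.Z l ∧ q.1 ∈ S.Z l) ↔ (entryGraph S.Z₀).Reachable p q) ∧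
      (∀ l, ∀ j ∈ cols (S.Z l), S.ColForm l j (f j)) ∧
      (∀ l, ∀ i ∈ rows (S.Z l), S.transpose.ColForm l i (g i)) := by
  obtain ⟨k, Z, hne, hrd, hcd, hZ, hreach⟩ := exists_blocks (dep (rowComp f₀ g))
  have hmemg : ∀ i j, (i, j) ∈ blockUnion Z ↔ j ∈ dep (g i) := fun i j => by
    rw [hZ, h.mem_dep_rowComp_iff]
  have hmem : ∀ i j, (i, j) ∈ blockUnion Z ↔ i ∈ dep (f j) := fun i j => by
    rw [hmemg, h.mem_dep_g_iff_mem_dep_f]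
  rw [← hZ] at hreach ⊢
  have hrow : ∀ i, rowEntries (blockUnion Z) i = dep (g i) := fun i => by
    ext j; rw [mem_rowEntries, hmemg]
  have hcol : ∀ j, colEntries (blockUnion Z) j = dep (f j) := fun j => by
    ext i; rw [mem_colEntries, hmem]
  have hsub : ∀ {l p}, p ∈ Z l → p ∈ blockUnion Z := fun {l p} hp =>
    Finset.mem_biUnion.2 ⟨l, Finset.mem_univ _, hp⟩
  have hrl : ∀ {l i j}, (i, j) ∈ Z l → rowEntries (Z l) i = rowEntries (blockUnion Z) i := by
    intro l i j hij
    ext j'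
    rw [mem_rowEntries, mem_rowEntries]
    refine ⟨hsub, fun h' => ?_⟩
    obtain ⟨l', -, hl'⟩ := Finset.mem_biUnion.1 h'
    by_cases hll : l = l'
    · rwa [hll]
    · exact absurd (mem_rows.2 ⟨j', hl'⟩)
        (Finset.disjoint_left.1 (hrd l l' hll) (mem_rows.2 ⟨j, hij⟩))
  have hcl : ∀ {l i j}, (i, j) ∈ Z l → colEntries (Z l) j = colEntries (blockUnion Z) j := by
    intro l i j hij
    ext i'
    rw [mem_colEntries, mem_colEntries]
    refine ⟨hsub, fun h' => ?_⟩
    obtain ⟨l', -, hl'⟩ := Finset.mem_biUnion.1 h'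
    by_cases hll : l = l'
    · rwa [hll]
    · exact absurd (mem_cols.2 ⟨i', hl'⟩)
        (Finset.disjoint_left.1 (hcd l l' hll) (mem_cols.2 ⟨i, hij⟩))
  have hr2 : ∀ i, CanalizingRow f g i → i ∈ rowsTwo (blockUnion Z) := fun i hi => by
    rw [mem_rowsTwo, hrow]; exact hi.1
  have hc2 : ∀ j, CanalizingRow g f j → j ∈ colsTwo (blockUnion Z) := fun j hj => by
    rw [mem_colsTwo, hcol]; exact hj.1
  -- whether a block is AND/OR-like can be seen at any of its positions
  let A : Fin n × Fin m → Prop := fun p => CanalizingRow f g p.1 ∨ CanalizingRow g f p.2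
  have hA : ∀ l, ∀ p ∈ Z l, ∀ q ∈ Z l, A p → A q := fun l p hp q hq hAp =>
    h.canalizing_of_reachable hmem
      ((hreach ⟨p, hsub hp⟩ ⟨q, hsub hq⟩).1 ⟨l, hp, hq⟩) hAp
  let kind : Fin k → BlockKind := fun l =>
    if (Z l).card = 1 then BlockKind.singleton
    else if ∃ p ∈ Z l, A p then BlockKind.andOr else BlockKind.xor
  have hsing : ∀ l, kind l = BlockKind.singleton ↔ (Z l).card = 1 := by
    intro l
    simp only [kind]
    split_ifs <;> simp_all
  have hxor : ∀ l, kind l = BlockKind.xor → ∀ i j, (i, j) ∈ Z l →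
      ¬ CanalizingRow f g i ∧ ¬ CanalizingRow g f j := by
    intro l hl i j hij
    have h1 : ¬ ∃ p ∈ Z l, A p := by
      intro h'
      simp only [kind, h', if_true] at hl
      split_ifs at hl
    exact ⟨fun h' => h1 ⟨_, hij, Or.inl h'⟩, fun h' => h1 ⟨_, hij, Or.inr h'⟩⟩
  have hand : ∀ l, kind l = BlockKind.andOr → ∀ i j, (i, j) ∈ Z l →
      (i ∈ rowsTwo (blockUnion Z) → CanalizingRow f g i) ∧
        (j ∈ colsTwo (blockUnion Z) → CanalizingRow g f j) := by
    intro l hl i j hij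
    have h1 : ∃ p ∈ Z l, A p := by
      by_contra h'
      simp only [kind, h', if_false] at hl
      split_ifs at hl
    obtain ⟨p, hp, hAp⟩ := h1
    have hf := (hmem i j).1 (hsub hij)
    have hg := (hmemg i j).1 (hsub hij)
    rcases hA l p hp _ hij hAp with h' | h'
    · refine ⟨fun _ => h', fun hj => h.canalizingRow_transpose h' hg ?_⟩
      rwa [mem_colsTwo, hcol] at hj
    · refine ⟨fun hi => h.transpose.canalizingRow_transpose h' hf ?_, fun _ => h'⟩
      rwa [mem_rowsTwo, hrow] at hi
  have hiso : ∀ l, (Z l).card ≠ 1 → ∀ i j, (i, j) ∈ Z l →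
      i ∈ rowsTwo (Z l) ∨ j ∈ colsTwo (Z l) := by
    intro l hl i j hij
    have h1 : 1 < (Z l).card := by
      have := (hne l).card_pos
      omega
    obtain ⟨q, hq, hqp⟩ := Finset.exists_mem_ne h1 (i, j)
    rw [mem_rowsTwo, mem_colsTwo, hrl hij, hcl hij, ← mem_rowsTwo, ← mem_colsTwo]
    exact mem_rowsTwo_or_mem_colsTwo_of_reachable
      ((hreach ⟨(i, j), hsub hij⟩ ⟨q, hsub hq⟩).1 ⟨l, hij, hq⟩)
      fun e => hqp (congrArg Subtype.val e).symm
  have hcard : ∀ l, kind l = BlockKind.xor → (Z l).card ≠ 1 := fun l hl hc => by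
    rw [(hsing l).2 hc] at hl
    cases hl
  have hrT : ∀ {l i}, i ∈ rowsTwo (Z l) → ∃ j, (i, j) ∈ Z l ∧ i ∈ rowsTwo (blockUnion Z) := by
    intro l i hi
    obtain ⟨j, hij⟩ := mem_rows.1 (rowsTwo_subset_rows hi)
    rw [mem_rowsTwo, hrl hij] at hi
    exact ⟨j, hij, mem_rowsTwo.2 hi⟩
  have hcT : ∀ {l j}, j ∈ colsTwo (Z l) → ∃ i, (i, j) ∈ Z l ∧ j ∈ colsTwo (blockUnion Z) := by
    intro l j hj
    obtain ⟨i, hij⟩ := mem_cols.1 (colsTwo_subset_cols hj)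
    rw [mem_colsTwo, hcl hij] at hj
    exact ⟨i, hij, mem_colsTwo.2 hj⟩
  -- in an XOR-like block, a one-element column meets a row with at least two elements
  have hcE : ∀ {l j}, kind l = BlockKind.xor → j ∈ colsOne (Z l) →
      colDepOne (blockUnion Z) j = ∅ := by
    intro l j hl hj
    refine Finset.eq_empty_of_forall_notMem fun i hi => ?_
    obtain ⟨a, haj⟩ := mem_cols.1 (colsOne_subset_cols hj)
    have hij : (i, j) ∈ Z l := by
      rw [← mem_colEntries, hcl haj, mem_colEntries]; exact (mem_colDepOne.1 hi).1
    obtain ⟨_, -, h1⟩ := hrT ((hiso l (hcard l hl) i j hij).resolve_right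
      (notMem_colsTwo_of_colsOne hj))
    exact notMem_rowsTwo_of_rowsOne (mem_colDepOne.1 hi).2 h1
  have hrE : ∀ {l i}, kind l = BlockKind.xor → i ∈ rowsOne (Z l) →
      rowDepOne (blockUnion Z) i = ∅ := by
    intro l i hl hi
    refine Finset.eq_empty_of_forall_notMem fun j hj => ?_
    obtain ⟨b, hib⟩ := Finset.card_pos.1 (by rw [mem_rowsOne.1 hi]; exact one_pos :
      0 < (rowEntries (Z l) i).card)
    have hij : (i, j) ∈ Z l := by
      rw [← mem_rowEntries, hrl (mem_rowEntries.1 hib), mem_rowEntries]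
      exact (mem_rowDepOne.1 hj).1
    obtain ⟨_, -, h1⟩ := hcT ((hiso l (hcard l hl) i j hij).resolve_left
      (notMem_rowsTwo_of_rowsOne hi))
    exact notMem_colsTwo_of_colsOne (mem_rowDepOne.1 hj).2 h1
  let S : SolutionData n m k :=
    { Z := Z
      nonempty := hne
      row_disjoint := hrd
      col_disjoint := hcd
      not_isolated := hiso
      kind := kind
      kind_singleton := hsing
      h := 1
      sgnF := fun j => f j 1
      sgnG := fun i => g i 1
      φ := fun j u => embedded f g (colDepOne (blockUnion Z) j) j
        fun i => if hi : i ∈ colDepOne (blockUnion Z) j then u ⟨i, hi⟩ else 1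
      γ := fun i u => embedded g f (rowDepOne (blockUnion Z) i) i
        fun j => if hj : j ∈ rowDepOne (blockUnion Z) i then u ⟨j, hj⟩ else 1
      B := fun j => if CanalizingRow g f j then val (openValue f g j) else 0
      D := fun i => if CanalizingRow f g i then val (openValue g f i) else 0
      κ := fun i j => if (i, j) ∈ blockUnion Z ∧ CanalizingRow f g i ∧ CanalizingRow g f j then
        val (commonValue f g i j) else 0
      B_eq_zero := fun j hj => if_neg fun h' => hj (hc2 j h')
      D_eq_zero := fun i hi => if_neg fun h' => hi (hr2 i h')
      κ_eq_zero := fun i j hij => if_neg fun h' => hij ⟨h'.1, hr2 i h'.2.1, hc2 j h'.2.2⟩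
      xor_col := fun l hl j hj => by
        obtain ⟨i, hij⟩ := mem_cols.1 hj
        exact ⟨if_neg (hxor l hl i j hij).2, fun u =>
          embedded_eq_one_or_neg_one (hxor l hl i j hij).2 _⟩
      xor_row := fun l hl i hi => by
        obtain ⟨j, hij⟩ := mem_rows.1 hi
        exact ⟨if_neg (hxor l hl i j hij).1, fun u =>
          embedded_eq_one_or_neg_one (hxor l hl i j hij).1 _⟩
      xor_shift := fun l hl i j hij => if_neg fun h' => (hxor l hl i j hij).1 h'.2.1
      xor_sgnF := fun l hl j hj u => by
        obtain ⟨i, hij⟩ := mem_cols.1 (colsOne_subset_cols hj)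
        simp only [hcE hl hj]
        exact embedded_empty (hxor l hl i j hij).2 _
      xor_sgnG := fun l hl i hi u => by
        obtain ⟨j, hij⟩ := Finset.card_pos.1 (by rw [mem_rowsOne.1 hi]; exact one_pos :
          0 < (rowEntries (Z l) i).card)
        simp only [hrE hl hi]
        exact embedded_empty (hxor l hl i j (mem_rowEntries.1 hij)).1 _
      andOr_col := fun l hl j hj => by
        obtain ⟨i, hij, hj'⟩ := hcT hj
        have hC := (hand l hl i j hij).2 hj'
        rw [if_pos hC]
        exact ⟨val_eq_one_or _, fun u => embedded_eq_zero_or_one hC _⟩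
      andOr_row := fun l hl i hi => by
        obtain ⟨j, hij, hi'⟩ := hrT hi
        have hC := (hand l hl i j hij).1 hi'
        rw [if_pos hC]
        exact ⟨val_eq_one_or _, fun u => embedded_eq_zero_or_one hC _⟩
      andOr_shift := fun l hl i j hij hi hj => by
        obtain ⟨_, -, hi'⟩ := hrT hi
        obtain ⟨_, -, hj'⟩ := hcT hj
        rw [if_pos ⟨hsub hij, (hand l hl i j hij).1 hi', (hand l hl i j hij).2 hj'⟩]
        exact val_eq_one_or _ }
  have hφ : ∀ j x, S.phiAt j x = embedded f g (colDepOne S.Z₀ j) j x := fun j x =>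
    embedded_congr fun i hi => dif_pos hi
  have hγ : ∀ i y, S.gammaAt i y = embedded g f (rowDepOne S.Z₀ i) i y := fun i y =>
    embedded_congr fun j hj => dif_pos hj
  have hZT : ∀ {j i}, (j, i) ∈ S.transpose.Z₀ ↔ (i, j) ∈ blockUnion Z := by
    intro j i
    rw [SolutionData.transpose_Z₀, mem_transposeSet]
    rfl
  refine ⟨k, S, rfl, hreach, fun l j hj => ?_, fun l i hi => ?_⟩
  · exact SolutionData.colForm_of_isReduced h hmem (fun _ => rfl) hφ (fun j hj => if_pos hj)
      (fun i j hij hi hj => if_pos ⟨hij, hi, hj⟩) hxor hand hj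
  · refine SolutionData.colForm_of_isReduced (S := S.transpose) h.transpose
      (fun j i => hZT.trans (hmemg i j)) (fun _ => rfl) (fun i y => ?_) (fun i hi => if_pos hi)
      (fun j i hij hj hi => ?_) (fun l hl j i hij => (hxor l hl i j (mem_transposeSet.1 hij)).symm)
      (fun l hl j i hij => ?_) ?_
    · rw [SolutionData.transpose_Z₀, colDepOne_transposeSet]
      exact hγ i y
    · rw [commonValue_comm]
      exact if_pos ⟨hZT.1 hij, hi, hj⟩
    · rw [SolutionData.transpose_Z₀, rowsTwo_transposeSet, colsTwo_transposeSet]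
      exact (hand l hl i j (mem_transposeSet.1 hij)).symm
    · rwa [SolutionData.transpose_Z, cols_transposeSet]

theorem IsReduced.exists_hasForm (h : IsReduced f₀ f g₀ g) :
    ∃ (k : ℕ) (S : SolutionData n m k), S.Z₀ = dep (rowComp f₀ g) ∧
      (∀ p q : {p : Fin n × Fin m // p ∈ S.Z₀},
        (∃ l, p.1 ∈ S.Z l ∧ q.1 ∈ S.Z l) ↔ (entryGraph S.Z₀).Reachable p q) ∧
      dep S.h = Finset.univ ∧ S.HasForm f₀ f g₀ g := by
  obtain ⟨k, S, hZ, hreach, hf, hg⟩ := h.exists_solutionData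
  choose F hF using S.exists_outerForm
  choose G hG using S.transpose.exists_outerForm
  have hmem : ∀ i j, (i, j) ∈ S.Z₀ ↔ i ∈ dep (f j) := fun i j => by
    rw [hZ, h.mem_dep_rowComp_iff, h.mem_dep_g_iff_mem_dep_f]
  have hfac : Function.FactorsThrough f₀ fun x l => F l x := fun x x' hx =>
    SolutionData.apply_eq_of_forall_outer_eq h hmem (fun p q => (hreach p q).1) hf hg hF hG
      (congrFun hx)
  let u : BoolFn (Fin k) := Function.extend (fun x l => F l x) f₀ 1
  have hu : ∀ x, f₀ x = u fun l => F l x := fun x => (hfac.extend_apply 1 x).symm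
  refine ⟨k, { S with h := u }, hZ, hreach, SolutionData.dep_eq_univ_of_factors h.dep_f₀ hF hu,
    F, G, hu, fun y => ?_, fun l => ?_⟩
  · obtain ⟨z, hz⟩ := rowVals_surjective h.f_nonConstant y
    have hz : colVals f (transposeMatrix z) = y := hz
    rw [← hz, ← h.gp.rowVals_eq_colVals, hu]
    exact congrArg u (funext fun l =>
      SolutionData.outer_rowVals_eq_outer_colVals (hf l) (hg l) (hF l) (hG l) _)
  · exact (S.blockForm_iff (l := l)).2 ⟨hf l, hg l, hF l, hG l⟩

end Main

end GenPoly

theorem mainTheorem2 :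
    (∀ (n m : ℕ) (f₀ : GenPoly.BoolFn (Fin n)) (f : Fin m → GenPoly.BoolFn (Fin n))
        (g₀ : GenPoly.BoolFn (Fin m)) (g : Fin n → GenPoly.BoolFn (Fin m)),
      GenPoly.IsGeneralizedPolymorphism f₀ f g₀ g →
      GenPoly.dep f₀ = Finset.univ → GenPoly.dep g₀ = Finset.univ →
      (∀ j, GenPoly.NonConstant (f j)) → (∀ i, GenPoly.NonConstant (g i)) →
      ∃ (k : ℕ) (S : GenPoly.SolutionData n m k),
        S.Z₀ = GenPoly.dep (GenPoly.rowComp f₀ g) ∧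
        (∀ i j, (i, j) ∈ S.Z₀ ↔ j ∈ GenPoly.dep (g i)) ∧
        (∀ i j, (i, j) ∈ S.Z₀ ↔ i ∈ GenPoly.dep (f j)) ∧
        (∀ p q : {p : Fin n × Fin m // p ∈ S.Z₀},
          (∃ l, p.1 ∈ S.Z l ∧ q.1 ∈ S.Z l) ↔ (GenPoly.entryGraph S.Z₀).Reachable p q) ∧
        (∀ i, (i ∈ GenPoly.rowsOne S.Z₀ ↔ GenPoly.degree (g i) = 1) ∧
          (i ∈ GenPoly.rowsTwo S.Z₀ ↔ 2 ≤ GenPoly.degree (g i))) ∧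
        (∀ j, (j ∈ GenPoly.colsOne S.Z₀ ↔ GenPoly.degree (f j) = 1) ∧
          (j ∈ GenPoly.colsTwo S.Z₀ ↔ 2 ≤ GenPoly.degree (f j))) ∧
        GenPoly.dep S.h = Finset.univ ∧
        S.HasForm f₀ f g₀ g) ∧
    (∀ (n m k : ℕ) (S : GenPoly.SolutionData n m k),
      (∃ (f₀ : GenPoly.BoolFn (Fin n)) (f : Fin m → GenPoly.BoolFn (Fin n))
        (g₀ : GenPoly.BoolFn (Fin m)) (g : Fin n → GenPoly.BoolFn (Fin m)),
        S.HasForm f₀ f g₀ g) ∧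
      ∀ (f₀ : GenPoly.BoolFn (Fin n)) (f : Fin m → GenPoly.BoolFn (Fin n))
        (g₀ : GenPoly.BoolFn (Fin m)) (g : Fin n → GenPoly.BoolFn (Fin m)),
        S.HasForm f₀ f g₀ g → GenPoly.IsGeneralizedPolymorphism f₀ f g₀ g) := by
  refine ⟨fun n m f₀ f g₀ g hP hf₀ hg₀ hf hg => ?_, fun n m k S =>
    ⟨S.exists_hasForm, fun _ _ _ _ h => h.isGeneralizedPolymorphism⟩⟩
  have h : GenPoly.IsReduced f₀ f g₀ g := ⟨hP, hf₀, hg₀, hf, hg⟩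
  obtain ⟨k, S, hZ, hreach, hdep, hform⟩ := h.exists_hasForm
  have hmemg : ∀ i j, (i, j) ∈ S.Z₀ ↔ j ∈ GenPoly.dep (g i) := fun i j => by
    rw [hZ, h.mem_dep_rowComp_iff]
  have hmemf : ∀ i j, (i, j) ∈ S.Z₀ ↔ i ∈ GenPoly.dep (f j) := fun i j => by
    rw [hmemg, h.mem_dep_g_iff_mem_dep_f]
  refine ⟨k, S, hZ, hmemg, hmemf, hreach, fun i => ?_, fun j => ?_, hdep, hform⟩
  · have hr : GenPoly.rowEntries S.Z₀ i = GenPoly.dep (g i) := by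
      ext j; rw [GenPoly.mem_rowEntries, hmemg]
    rw [GenPoly.mem_rowsOne, GenPoly.mem_rowsTwo, hr, GenPoly.degree_eq_one_iff (hg i),
      GenPoly.two_le_degree_iff (hg i)]
    exact ⟨Iff.rfl, Iff.rfl⟩
  · have hc : GenPoly.colEntries S.Z₀ j = GenPoly.dep (f j) := by
      ext i; rw [GenPoly.mem_colEntries, hmemf]
    rw [GenPoly.mem_colsOne, GenPoly.mem_colsTwo, hc, GenPoly.degree_eq_one_iff (hf j),
      GenPoly.two_le_degree_iff (hf j)]
    exact ⟨Iff.rfl, Iff.rfl⟩
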